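/- Let $K$ be a finite abstract simplicial complex with vertex set $S$ (it contains $\varnothing$ and $\{v\}$ for all $v\in S$). For $n\ge -1$ let $C_n(K)=C^n(K)$ be the abelian group generated by the sequences $(v_0,\dots,v_n)$ in $S$, where a sequence is $0$ if it has a repeated entry or does not span a simplex of $K$, and exchanging two entries changes the sign; $C_{-1}(K)=\mathbb Z$ is generated by $(\varnothing)$. For nonzero $(v_0,\dots,v_k)$ put $$d(v_0,\dots,v_k)=\sum_{i=0}^k(-1)^i(v_0,\dots,\hat v_i,\dots,v_k),\qquad \delta(v_0,\dots,v_k)=\sum_{v\in S}(v,v_0,\dots,v_k).$$ Let $C_*(K)=C^*(K)=\bigoplus_{k\ge 0}C_k(K)$ (with $d(v)=0$), and let $H_*(K)$, $H^*(K)$ be the homology of $(C_*(K),d)$ and the cohomology of $(C^*(K),\delta)$. Let $\widetilde C_*(K)=\widetilde C^*(K)=\bigoplus_{k\ge -1}C_k(K)$ (with $d(v)=(\varnothing)$, $\delta(\varnothing)=\sum_{v\in S}(v)$). Let $N^{p,q}(K)\subset C_p(K)\otimes C^q(K)$, $p,q\ge 0$, be the subgroup generated by all $\sigma\otimes\tau$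 with $\sigma\subset\tau$. With $\Delta(\sigma\otimes\tau)=d\sigma\otimes\tau+(-1)^{|\sigma|}\sigma\otimes\delta\tau$, where $|\sigma|$ is the number of vertices of $\sigma$, these form a double complex $N(K)$ with total complex $T^n(N(K))=\bigoplus_{q-p=n}N^{p,q}(K)$. Let $N_{p,q}(K)=\mathrm{Hom}_{\mathbb Z}(N^{p,q}(K),\mathbb Z)$ form the dual double complex, with the transposed differential $D$ and total complex $T_n(N(K))=\bigoplus_{q-p=n}N_{p,q}(K)$. The reduced double complex $\widetilde N(K)$ and its dual are defined in the same way from $\widetilde C_*(K)\otimes\widetilde C^*(K)$, with $p,q\ge -1$. Then for all $n\in\mathbb Z$ $$H^n\big(T^*(N(K)),\Delta\big)\cong H^n(K),\qquad H_n\big(T_*(N(K)),D\big)\cong H_n(K),$$ and $$H^*\big(T^*(\widetilde N(K)),\Delta\big)\cong\mathbb Z,\qquad H_*\big(T_*(\widetilde N(K)),D\big)\cong\mathbb Z,$$ the latter two concentrated in degree $0$. Consequently the cohomeology spectral sequence $E_r^{p,q}(K)$, given by the filtration $F^p=\bigoplus_{i\le p}N^{i,*}(K)$ of $T^*(N(K))$,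 with $\Delta_r\colon E_r^{p,q}\to E_r^{p-r,q-r+1}$, converges to $H^{q-p}(K)$, and the homeology spectral sequence $E^r_{p,q}(K)$, given by the filtration $F_p=\bigoplus_{i\ge p}N_{i,*}(K)$ of $T_*(N(K))$, with $D_r\colon E^r_{p,q}\to E^r_{p+r,q+r-1}$, converges to $H_{q-p}(K)$. That is, each limit group has a finite filtration, monotone in $p$, whose successive quotients are the terms $E_\infty^{p,q}(K)$, respectively $E^\infty_{p,q}(K)$, with $q-p$ the degree of the group, where for every $p,q$ the differentials into and out of the $(p,q)$ term vanish for all large $r$ and the $\infty$-term is the $r$-th term for large $r$. -/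

import Mathlib

open CategoryTheory
open scoped TensorProduct

noncomputable section

namespace Homeology

universe u

set_option linter.unusedSectionVars false

/-! ## Chains of a simplicial complex

A finite abstract simplicial complex with vertex set `V` is an `AbstractSimplicialComplex V`
with `V` finite; its `faces` are the nonempty simplices, and the empty set is added here. -/

/-- `s` is a (possibly empty) simplex of `K`. -/
def IsFace {V : Type u} (K : AbstractSimplicialComplex V) (s : Finset V) : Prop :=
  s = ∅ ∨ s ∈ K.faces

/-- The relations between ordered sequences of vertices: a sequence is zero if it has a repeated
entry or if it does not span a simplex of `K`, and exchanging two entries changes the sign. -/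
def relations {V : Type u} [DecidableEq V] (K : AbstractSimplicialComplex V) :
    Set (List V →₀ ℤ) :=
  {x | ∃ l : List V, (¬ l.Nodup ∨ ¬ IsFace K l.toFinset) ∧ x = Finsupp.single l 1} ∪
  {x | ∃ (l₁ l₂ l₃ : List V) (a b : V),
    x = Finsupp.single (l₁ ++ a :: (l₂ ++ b :: l₃)) 1
      + Finsupp.single (l₁ ++ b :: (l₂ ++ a :: l₃)) 1}

/-- The direct sum of all chain groups `C_k(K)`, `k ≥ -1`: the free abelian group on the finite
sequences of vertices modulo `relations`. The empty sequence generates `C_{-1}(K)`. -/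
def Chains {V : Type u} [DecidableEq V] (K : AbstractSimplicialComplex V) : Type u :=
  (List V →₀ ℤ) ⧸ Submodule.span ℤ (relations K)

instance {V : Type u} [DecidableEq V] (K : AbstractSimplicialComplex V) :
    AddCommGroup (Chains K) :=
  inferInstanceAs (AddCommGroup ((List V →₀ ℤ) ⧸ Submodule.span ℤ (relations K)))

/-- The quotient map. -/
def chainMk {V : Type u} [DecidableEq V] (K : AbstractSimplicialComplex V) :
    (List V →₀ ℤ) →ₗ[ℤ] Chains K where
  toFun x := (Submodule.Quotient.mk x : (List V →₀ ℤ) ⧸ Submodule.span ℤ (relations K))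
  map_add' _ _ := rfl
  map_smul' n x :=
     map_zsmul (Submodule.mkQ (Submodule.span ℤ (relations K))).toAddMonoidHom n x

/-- The class `(v₀, …, v_k)` of a sequence of vertices. -/
def simplex {V : Type u} [DecidableEq V] (K : AbstractSimplicialComplex V) (l : List V) :
    Chains K :=
  chainMk K (Finsupp.single l 1)

/-- The homomorphism induced on the quotient by a function on sequences. -/
def chainLift {V : Type u} [DecidableEq V] {K : AbstractSimplicialComplex V} {M : Type u}
    [AddCommGroup M] (f : List V → M)
    (h : Submodule.span ℤ (relations K) ≤ LinearMap.ker (Finsupp.linearCombination ℤ f)) :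
    Chains K →ₗ[ℤ] M :=
  AddMonoidHom.toIntLinearMap
    ((Submodule.liftQ (Submodule.span ℤ (relations K)) (Finsupp.linearCombination ℤ f)
      h).toAddMonoidHom :
      ((List V →₀ ℤ) ⧸ Submodule.span ℤ (relations K)) →+ M)

/-- The chain group `C_n(K)` inside `Chains K`, restricted to simplices with at least `a`
vertices: `a = 1` gives the groups of `C_*(K)`, and `a = 0` those of the reduced complex. -/
def chainGroup {V : Type u} [DecidableEq V] (K : AbstractSimplicialComplex V) (a : ℕ) (n : ℤ) :
    Submodule ℤ (Chains K) :=
  Submodule.span ℤ {x | ∃ l : List V, a ≤ l.length ∧ (l.length : ℤ) = n + 1 ∧ x = simplex K l}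

section aux

variable {V : Type u} [DecidableEq V] {K : AbstractSimplicialComplex V}

theorem chainMk_eq_zero {x : List V →₀ ℤ} (h : x ∈ Submodule.span ℤ (relations K)) :
    chainMk K x = 0 :=
  (Submodule.Quotient.mk_eq_zero _).2 h

theorem chainLift_simplex {M : Type u} [AddCommGroup M] (f : List V → M)
    (h : Submodule.span ℤ (relations K) ≤ LinearMap.ker (Finsupp.linearCombination ℤ f))
    (l : List V) : chainLift f h (simplex K l) = f l := by
  have : Finsupp.linearCombination ℤ f (Finsupp.single l 1) = f l := by
    rw [Finsupp.linearCombination_single, one_smul]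
  exact this

theorem simplex_eq_zero {l : List V} (h : ¬ l.Nodup ∨ ¬ IsFace K l.toFinset) :
    simplex K l = 0 :=
  chainMk_eq_zero (Submodule.subset_span (Or.inl ⟨l, h, rfl⟩))

theorem simplex_swap (l₁ l₂ l₃ : List V) (a b : V) :
    simplex K (l₁ ++ a :: (l₂ ++ b :: l₃)) + simplex K (l₁ ++ b :: (l₂ ++ a :: l₃)) = 0 :=
  chainMk_eq_zero
    (Submodule.subset_span (Or.inr ⟨l₁, l₂, l₃, a, b, rfl⟩))

theorem isFace_mono {s t : Finset V} (h : IsFace K t) (hst : s ⊆ t) : IsFace K s := by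
  rcases s.eq_empty_or_nonempty with rfl | hs
  · exact Or.inl rfl
  · rcases h with rfl | h
    · exact absurd (Finset.subset_empty.1 hst) hs.ne_empty
    · exact Or.inr ((K.isRelLowerSet_faces h).2 hst hs)

theorem exists_of_not_nodup {l : List V} (h : ¬ l.Nodup) :
    ∃ (l₁ l₂ l₃ : List V) (a : V), l = l₁ ++ a :: (l₂ ++ a :: l₃) := by
  induction l with
  | nil => simp at h
  | cons x l ih =>
    by_cases hx : x ∈ l
    · obtain ⟨s, t, rfl⟩ := List.append_of_mem hx
      exact ⟨[], s, t, x, rfl⟩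
    · have : ¬ l.Nodup := fun hl => h (List.nodup_cons.2 ⟨hx, hl⟩)
      obtain ⟨l₁, l₂, l₃, a, rfl⟩ := ih this
      exact ⟨x :: l₁, l₂, l₃, a, rfl⟩

/-- A function on sequences that is alternating in adjacent entries and vanishes off `K` descends
to `Chains K`. -/
theorem lift_aux {M : Type u} [AddCommGroup M] (f : List V → M)
    (hadj : ∀ (l m : List V) (a b : V), f (l ++ a :: b :: m) + f (l ++ b :: a :: m) = 0)
    (hrep : ∀ (l m : List V) (a : V), f (l ++ a :: a :: m) = 0)
    (hface : ∀ l : List V, ¬ IsFace K l.toFinset → f l = 0) :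
    Submodule.span ℤ (relations K) ≤ LinearMap.ker (Finsupp.linearCombination ℤ f) := by
  have move : ∀ (l₂ l m : List V) (a : V),
      f (l ++ a :: (l₂ ++ m)) = (-1 : ℤ) ^ l₂.length • f (l ++ (l₂ ++ a :: m)) := by
    intro l₂
    induction l₂ with
    | nil => intro l m a; simp
    | cons x l₂ ih =>
      intro l m a
      have h1 := eq_neg_of_add_eq_zero_left (hadj l (l₂ ++ m) a x)
      have h2 := ih (l ++ [x]) m a
      simp only [List.append_assoc, List.cons_append, List.nil_append] at h1 h2 ⊢
      rw [h1, h2, List.length_cons, pow_succ]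
      simp
  rw [Submodule.span_le]
  rintro x (⟨l, h, rfl⟩ | ⟨l₁, l₂, l₃, a, b, rfl⟩)
  · simp only [SetLike.mem_coe, LinearMap.mem_ker, Finsupp.linearCombination_single, one_smul]
    rcases h with h | h
    · obtain ⟨l₁, l₂, l₃, a, rfl⟩ := exists_of_not_nodup h
      rw [move]
      have := hrep (l₁ ++ l₂) l₃ a
      rw [List.append_assoc] at this
      rw [this, smul_zero]
    · exact hface l h
  · simp only [SetLike.mem_coe, LinearMap.mem_ker, map_add, Finsupp.linearCombination_single,
      one_smul]
    rw [move, move]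
    have := hadj (l₁ ++ l₂) l₃ a b
    rw [List.append_assoc, List.append_assoc] at this
    rw [← smul_add, this, smul_zero]

theorem chains_induction {p : Chains K → Prop} (h0 : p 0)
    (hadd : ∀ x y, p x → p y → p (x + y)) (hsmul : ∀ (n : ℤ) x, p x → p (n • x))
    (hs : ∀ l, p (simplex K l)) (x : Chains K) : p x := by
  obtain ⟨x, rfl⟩ : ∃ y, chainMk K y = x := Submodule.Quotient.mk_surjective _ x
  induction x using Finsupp.induction_linear with
  | zero => rw [map_zero]; exact h0
  | add f g hf hg => rw [map_add]; exact hadd _ _ hf hg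
  | single l n =>
    have : chainMk K (Finsupp.single l n) = n • simplex K l := by
      rw [simplex, ← map_smul, Finsupp.smul_single, smul_eq_mul, mul_one]
    rw [this]
    exact hsmul _ _ (hs l)

theorem chains_hom_ext {M : Type*} [AddCommGroup M] {f g : Chains K →ₗ[ℤ] M}
    (h : ∀ l, f (simplex K l) = g (simplex K l)) : f = g := by
  refine LinearMap.ext fun x => ?_
  induction x using chains_induction with
  | h0 => rw [map_zero, map_zero]
  | hadd x y hx hy => rw [map_add, map_add, hx, hy]
  | hsmul n x hx => rw [map_smul, map_smul, hx]
  | hs l => exact h l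

end aux

/-! ### The coboundary -/

/-- The linear map `(v₀, …, v_k) ↦ (v, v₀, …, v_k)`. -/
def consVertex {V : Type u} [DecidableEq V] (K : AbstractSimplicialComplex V) (v : V) :
    Chains K →ₗ[ℤ] Chains K :=
  chainLift (fun l => simplex K (v :: l)) (by
    apply lift_aux
    · intro l m a b
      exact simplex_swap (v :: l) [] m a b
    · intro l m a
      refine simplex_eq_zero (Or.inl fun h => ?_)
      have h' := (List.nodup_append.1 (List.nodup_cons.1 h).2).2.1
      simp at h'
    · intro l hl
      refine simplex_eq_zero (Or.inr fun h => hl (isFace_mono h ?_))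
      intro x hx
      simp only [List.mem_toFinset, List.mem_cons] at hx ⊢
      exact Or.inr hx)

/-- The coboundary `δ (v₀, …, v_k) = ∑ v, (v, v₀, …, v_k)`. -/
def coboundary {V : Type u} [Fintype V] [DecidableEq V] (K : AbstractSimplicialComplex V) :
    Chains K →ₗ[ℤ] Chains K :=
  ∑ v : V, consVertex K v

/-! ### The boundary -/

/-- `∑ i, (-1)^i (v₀, …, v̂ᵢ, …, v_k)`, as a formal sum of sequences. -/
def boundaryList {V : Type u} (l : List V) : List V →₀ ℤ :=
  ∑ i ∈ Finset.range l.length, (-1 : ℤ) ^ i • Finsupp.single (l.eraseIdx i) 1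

section aux

variable {V : Type u} [DecidableEq V] {K : AbstractSimplicialComplex V}

theorem consVertex_simplex (v : V) (l : List V) :
    consVertex K v (simplex K l) = simplex K (v :: l) :=
  chainLift_simplex _ _ l

/-- Prepending `v`, on formal sums. -/
def consFree (v : V) : (List V →₀ ℤ) →ₗ[ℤ] (List V →₀ ℤ) :=
  Finsupp.lmapDomain ℤ ℤ (fun l => v :: l)

theorem boundaryList_cons (v : V) (l : List V) :
    boundaryList (v :: l) = Finsupp.single l 1 - consFree v (boundaryList l) := by
  rw [boundaryList, List.length_cons, Finset.sum_range_succ']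
  simp only [List.eraseIdx_cons_succ, pow_zero, List.eraseIdx_cons_zero, one_smul,
    boundaryList, map_sum, map_smul, consFree, Finsupp.lmapDomain_apply,
    Finsupp.mapDomain_single]
  rw [add_comm, sub_eq_add_neg, ← Finset.sum_neg_distrib]
  congr 1
  refine Finset.sum_congr rfl fun i _ => ?_
  rw [pow_succ, mul_neg_one, neg_smul]

theorem mk_consFree (v : V) (x : List V →₀ ℤ) :
    chainMk K (consFree v x) = consVertex K v (chainMk K x) := by
  have h : chainMk K ∘ₗ consFree v = consVertex K v ∘ₗ chainMk K := by
    apply Finsupp.lhom_ext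
    intro l n
    have h : Finsupp.single l n = n • (Finsupp.single l 1 : List V →₀ ℤ) := by simp
    rw [h, map_smul, map_smul, LinearMap.comp_apply, LinearMap.comp_apply]
    congr 1
    rw [consFree, Finsupp.lmapDomain_apply, Finsupp.mapDomain_single]
    exact (consVertex_simplex v l).symm
  exact LinearMap.congr_fun h x

/-- The class of `boundaryList l`. -/
def bd (K : AbstractSimplicialComplex V) (l : List V) : Chains K :=
  chainMk K (boundaryList l)

theorem bd_cons (v : V) (l : List V) :
    bd K (v :: l) = simplex K l - consVertex K v (bd K l) := by
  rw [bd, boundaryList_cons, map_sub, mk_consFree]; rfl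

theorem consVertex_swap (a b : V) (x : Chains K) :
    consVertex K a (consVertex K b x) + consVertex K b (consVertex K a x) = 0 := by
  induction x using chains_induction with
  | h0 => simp
  | hadd x y hx hy =>
    simp only [map_add]
    rw [add_add_add_comm, hx, hy, add_zero]
  | hsmul n x hx => simp only [map_smul, ← smul_add, hx, smul_zero]
  | hs l =>
    simp only [consVertex_simplex]
    exact simplex_swap [] [] l a b

theorem consVertex_self (a : V) (x : Chains K) :
    consVertex K a (consVertex K a x) = 0 := by
  induction x using chains_induction with
  | h0 => simp
  | hadd x y hx hy => simp only [map_add, hx, hy, add_zero]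
  | hsmul n x hx => simp only [map_smul, hx, smul_zero]
  | hs l =>
    simp only [consVertex_simplex]
    exact simplex_eq_zero (Or.inl (by simp))

theorem bd_swap (l m : List V) (a b : V) :
    bd K (l ++ a :: b :: m) + bd K (l ++ b :: a :: m) = 0 := by
  induction l with
  | nil =>
    simp only [List.nil_append, bd_cons, map_sub, consVertex_simplex]
    have := consVertex_swap (K := K) a b (bd K m)
    rw [← this]
    abel
  | cons x l ih =>
    simp only [List.cons_append, bd_cons]
    have h1 := simplex_swap (K := K) l [] m a b
    simp only [List.nil_append] at h1
    rw [sub_add_sub_comm, h1, ← map_add, ih, map_zero, sub_zero]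

theorem bd_rep (l m : List V) (a : V) : bd K (l ++ a :: a :: m) = 0 := by
  induction l with
  | nil =>
    simp only [List.nil_append, bd_cons, map_sub, consVertex_simplex, consVertex_self]
    abel
  | cons x l ih =>
    rw [List.cons_append, bd_cons, ih, map_zero, sub_zero]
    refine simplex_eq_zero (Or.inl fun h => ?_)
    have h' := (List.nodup_append.1 h).2.1
    simp at h'

end aux

open Classical in
/-- The boundary of the chain complex formed by the simplices with at least `a` vertices:
`d (v₀, …, v_k) = ∑ i, (-1)^i (v₀, …, v̂ᵢ, …, v_k)` for every simplex of `K` with more than `a`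
vertices, and `d = 0` on the simplices with at most `a` vertices. So `d (v) = 0` for `a = 1`
(unreduced) and `d (v) = (∅)` for `a = 0` (reduced). -/
def boundary {V : Type u} [DecidableEq V] (K : AbstractSimplicialComplex V) (a : ℕ) :
    Chains K →ₗ[ℤ] Chains K :=
  chainLift (fun l : List V =>
    if IsFace K l.toFinset ∧ a < l.length then chainMk K (boundaryList l) else 0) (by
    apply lift_aux
    · intro l m x y
      have h1 : (l ++ x :: y :: m).toFinset = (l ++ y :: x :: m).toFinset := by
        ext z; simp; tauto
      have h2 : (l ++ x :: y :: m).length = (l ++ y :: x :: m).length := by simp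
      rw [h1, h2]
      split_ifs
      · exact bd_swap l m x y
      · simp
    · intro l m x
      split_ifs
      · exact bd_rep l m x
      · rfl
    · intro l hl
      rw [if_neg fun h => hl h.1])

/-- The sign operator `σ ↦ (-1)^{|σ|} σ`, with `|σ|` the number of vertices of `σ`. -/
def signOp {V : Type u} [DecidableEq V] (K : AbstractSimplicialComplex V) :
    Chains K →ₗ[ℤ] Chains K :=
  chainLift (fun l : List V => (-1 : ℤ) ^ l.length • simplex K l) (by
    apply lift_aux
    · intro l m x y
      have h2 : (l ++ x :: y :: m).length = (l ++ y :: x :: m).length := by simp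
      have h1 := simplex_swap (K := K) l [] m x y
      simp only [List.nil_append] at h1
      rw [h2, ← smul_add, h1, smul_zero]
    · intro l m x
      rw [simplex_eq_zero (Or.inl fun h => ?_), smul_zero]
      have h' := (List.nodup_append.1 h).2.1
      simp at h'
    · intro l hl
      rw [simplex_eq_zero (Or.inr hl), smul_zero])

section aux

variable {V : Type u} [DecidableEq V] {K : AbstractSimplicialComplex V}

theorem mk_boundaryList (l : List V) :
    chainMk K (boundaryList l) =
      ∑ i ∈ Finset.range l.length, (-1 : ℤ) ^ i • simplex K (l.eraseIdx i) := by
  simp only [boundaryList, map_sum, map_smul]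
  rfl

open Classical in
theorem boundary_mk_single (a : ℕ) (l : List V) :
    boundary K a (simplex K l) = if IsFace K l.toFinset ∧ a < l.length then
      chainMk K (boundaryList l) else 0 :=
  chainLift_simplex _ _ l

theorem boundary_simplex (a : ℕ) (l : List V) (hl : IsFace K l.toFinset) (ha : a < l.length) :
    boundary K a (simplex K l) =
      ∑ i ∈ Finset.range l.length, (-1 : ℤ) ^ i • simplex K (l.eraseIdx i) := by
  rw [boundary_mk_single, if_pos ⟨hl, ha⟩, mk_boundaryList]

theorem boundary_simplex_of_le (a : ℕ) (l : List V) (ha : l.length ≤ a) :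
    boundary K a (simplex K l) = 0 := by
  rw [boundary_mk_single, if_neg fun h => absurd h.2 (not_lt.2 ha)]

theorem signOp_simplex (l : List V) :
    signOp K (simplex K l) = (-1 : ℤ) ^ l.length • simplex K l :=
  chainLift_simplex _ _ l

theorem coboundary_simplex [Fintype V] (l : List V) :
    coboundary K (simplex K l) = ∑ v : V, simplex K (v :: l) := by
  simp only [coboundary, LinearMap.sum_apply, consVertex_simplex]

/-- The boundary on formal sums. -/
def boundaryFree : (List V →₀ ℤ) →ₗ[ℤ] (List V →₀ ℤ) :=
  Finsupp.linearCombination ℤ boundaryList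

theorem boundaryFree_consFree (v : V) (x : List V →₀ ℤ) :
    boundaryFree (consFree v x) = x - consFree v (boundaryFree x) := by
  induction x using Finsupp.induction_linear with
  | zero => simp
  | add f g hf hg => rw [map_add, map_add, hf, hg, map_add, map_add]; abel
  | single l n =>
    have h : Finsupp.single l n = n • (Finsupp.single l 1 : List V →₀ ℤ) := by simp
    rw [h]
    simp only [map_smul]
    rw [← smul_sub]
    congr 1
    rw [consFree, Finsupp.lmapDomain_apply, Finsupp.mapDomain_single, boundaryFree,
      Finsupp.linearCombination_single, Finsupp.linearCombination_single, one_smul, one_smul,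
      boundaryList_cons, consFree, Finsupp.lmapDomain_apply]

theorem boundaryFree_boundaryList (l : List V) : boundaryFree (boundaryList l) = 0 := by
  induction l with
  | nil => simp [boundaryList]
  | cons v l ih =>
    rw [boundaryList_cons, map_sub, boundaryFree_consFree, ih, map_zero, sub_zero, boundaryFree,
      Finsupp.linearCombination_single, one_smul, sub_self]

theorem boundary_comp_boundary (a : ℕ) : boundary K a ∘ₗ boundary K a = 0 := by
  apply chains_hom_ext
  intro l
  rw [LinearMap.comp_apply, LinearMap.zero_apply]
  by_cases hl : IsFace K l.toFinset ∧ a < l.length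
  · rw [boundary_simplex a l hl.1 hl.2]
    by_cases ha : a + 1 < l.length
    · have h1 : ∀ i ∈ Finset.range l.length,
          boundary K a ((-1 : ℤ) ^ i • simplex K (l.eraseIdx i)) =
            chainMk K
              (boundaryFree ((-1 : ℤ) ^ i • Finsupp.single (l.eraseIdx i) 1)) := by
        intro i hi
        have hi' := Finset.mem_range.1 hi
        have hle : (l.eraseIdx i).length = l.length - 1 := List.length_eraseIdx_of_lt hi'
        have hf : IsFace K (l.eraseIdx i).toFinset := by
          refine isFace_mono hl.1 fun x hx => ?_
          rw [List.mem_toFinset] at hx ⊢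
          exact List.mem_of_mem_eraseIdx hx
        rw [map_smul, map_smul, map_smul, boundary_mk_single, if_pos ⟨hf, by omega⟩]
        congr 1
        rw [boundaryFree, Finsupp.linearCombination_single, one_smul]
      rw [map_sum, Finset.sum_congr rfl h1, ← map_sum, ← map_sum]
      exact (congrArg (chainMk K) (boundaryFree_boundaryList l)).trans (map_zero _)
    · rw [map_sum]
      refine Finset.sum_eq_zero fun i hi => ?_
      have hle : (l.eraseIdx i).length = l.length - 1 :=
        List.length_eraseIdx_of_lt (Finset.mem_range.1 hi)
      rw [map_smul, boundary_simplex_of_le _ _ (by omega), smul_zero]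
  · rw [boundary_mk_single, if_neg hl, map_zero]

theorem coboundary_comp_coboundary [Fintype V] : coboundary K ∘ₗ coboundary K = 0 := by
  have key : ∀ (s : Finset V) (x : Chains K),
      ∑ v ∈ s, consVertex K v (∑ w ∈ s, consVertex K w x) = 0 := by
    intro s x
    induction s using Finset.induction_on with
    | empty => simp
    | insert a s ha ih =>
      rw [Finset.sum_insert ha, Finset.sum_insert ha, map_add, consVertex_self, zero_add]
      simp only [map_add]
      rw [Finset.sum_add_distrib, ih, add_zero, map_sum, ← Finset.sum_add_distrib]
      exact Finset.sum_eq_zero fun v _ => consVertex_swap a v x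
  refine LinearMap.ext fun x => ?_
  simpa only [coboundary, LinearMap.comp_apply, LinearMap.sum_apply, LinearMap.zero_apply]
    using key Finset.univ x

theorem boundary_signOp (a : ℕ) (x : Chains K) :
    boundary K a (signOp K x) + signOp K (boundary K a x) = 0 := by
  induction x using chains_induction with
  | h0 => simp
  | hadd x y hx hy =>
    simp only [map_add]
    rw [add_add_add_comm, hx, hy, add_zero]
  | hsmul n x hx => simp only [map_smul, ← smul_add, hx, smul_zero]
  | hs l =>
    rw [signOp_simplex, map_smul]
    by_cases hl : IsFace K l.toFinset ∧ a < l.length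
    · rw [boundary_simplex a l hl.1 hl.2, map_sum, Finset.smul_sum, ← Finset.sum_add_distrib]
      refine Finset.sum_eq_zero fun i hi => ?_
      have hlt := Finset.mem_range.1 hi
      have hle : (l.eraseIdx i).length + 1 = l.length := by
        rw [List.length_eraseIdx_of_lt hlt]; omega
      rw [map_smul, signOp_simplex, ← hle, pow_succ, smul_comm, ← smul_add, ← add_smul]
      simp
    · rw [boundary_mk_single, if_neg hl, map_zero, smul_zero, add_zero]

theorem boundary_mem {a : ℕ} {i j : ℤ} (hij : j + 1 = i) {x : Chains K}
    (hx : x ∈ chainGroup K a i) : boundary K a x ∈ chainGroup K a j := by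
  suffices h : chainGroup K a i ≤ (chainGroup K a j).comap (boundary K a) from h hx
  rw [chainGroup, Submodule.span_le]
  rintro _ ⟨l, hla, hl, rfl⟩
  rw [SetLike.mem_coe, Submodule.mem_comap]
  by_cases h : IsFace K l.toFinset ∧ a < l.length
  · rw [boundary_simplex a l h.1 h.2]
    refine Submodule.sum_mem _ fun k hk => Submodule.smul_mem _ _ (Submodule.subset_span ?_)
    have hle := List.length_eraseIdx_of_lt (Finset.mem_range.1 hk)
    exact ⟨l.eraseIdx k, by omega, by omega, rfl⟩
  · rw [boundary_mk_single, if_neg h]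
    exact Submodule.zero_mem _

theorem coboundary_mem [Fintype V] {a : ℕ} {i j : ℤ} (hij : i + 1 = j) {x : Chains K}
    (hx : x ∈ chainGroup K a i) : coboundary K x ∈ chainGroup K a j := by
  suffices h : chainGroup K a i ≤ (chainGroup K a j).comap (coboundary K) from h hx
  rw [chainGroup, Submodule.span_le]
  rintro _ ⟨l, hla, hl, rfl⟩
  rw [SetLike.mem_coe, Submodule.mem_comap, coboundary_simplex]
  refine Submodule.sum_mem _ fun v _ => Submodule.subset_span ?_
  exact ⟨v :: l, by rw [List.length_cons]; omega, by rw [List.length_cons]; push_cast; omega, rfl⟩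

end aux

/-! ## Simplicial homology and cohomology -/

open Classical in
/-- The complex with `n`-th term the subgroup `G n` of `A` and with the differentials induced
by an endomorphism `D` of `A`. -/
def complexOfEnd {R : Type} [CommRing R] {A : Type u} [AddCommGroup A] [Module R A]
    (c : ComplexShape ℤ) (D : A →ₗ[R] A) (G : ℤ → Submodule R A)
    (hG : ∀ i j, c.Rel i j → ∀ x ∈ G i, D x ∈ G j) (hD : D ∘ₗ D = 0) :
    HomologicalComplex (ModuleCat.{u} R) c where
  X n := ModuleCat.of R (G n)
  d i j := if h : c.Rel i j then ModuleCat.ofHom (D.restrict (hG i j h)) else 0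
  shape i j h := dif_neg h
  d_comp_d' i j k hij hjk := by
    rw [dif_pos hij, dif_pos hjk]
    ext x
    simpa using LinearMap.congr_fun hD (x : A)

/-- The simplicial chain complex `(C_*(K), d)`, without the empty simplex. Its homology is
`H_*(K)`. -/
def chainComplex {V : Type u} [DecidableEq V] (K : AbstractSimplicialComplex V) :
    ChainComplex (ModuleCat.{u} ℤ) ℤ :=
  complexOfEnd (ComplexShape.down ℤ) (boundary K 1) (chainGroup K 1)
    (fun _ _ h _ hx => boundary_mem h hx) (boundary_comp_boundary 1)

/-- The simplicial cochain complex `(C^*(K), δ)`, without the empty simplex. Its cohomology is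
`H^*(K)`. -/
def cochainComplex {V : Type u} [Fintype V] [DecidableEq V] (K : AbstractSimplicialComplex V) :
    CochainComplex (ModuleCat.{u} ℤ) ℤ :=
  complexOfEnd (ComplexShape.up ℤ) (coboundary K) (chainGroup K 1)
    (fun _ _ h _ hx => coboundary_mem h hx) coboundary_comp_coboundary

/-! ## The double complex `N(K)`

As for chains, the parameter `a` is `1` for `N(K)` and `0` for the reduced double complex. -/

/-- The module structure of the tensor product, given priority over the general `ℤ`-module
structure of an abelian group. -/
instance {V : Type u} [DecidableEq V] (K : AbstractSimplicialComplex V) :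
    Module ℤ (Chains K ⊗[ℤ] Chains K) :=
  TensorProduct.instModule

/-- `N^{p,q}`: the subgroup of `C_p(K) ⊗ C^q(K)` generated by the `σ ⊗ τ` with `σ ⊆ τ`. -/
def doubleGroup {V : Type u} [DecidableEq V] (K : AbstractSimplicialComplex V) (a : ℕ)
    (p q : ℤ) : Submodule ℤ (Chains K ⊗[ℤ] Chains K) :=
  Submodule.span ℤ {x | ∃ s t : List V, a ≤ s.length ∧ (s.length : ℤ) = p + 1 ∧
    (t.length : ℤ) = q + 1 ∧ s ⊆ t ∧ x = simplex K s ⊗ₜ[ℤ] simplex K t}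

/-- `Δ (σ ⊗ τ) = dσ ⊗ τ + (-1)^{|σ|} σ ⊗ δτ`. -/
def doubleDiff {V : Type u} [Fintype V] [DecidableEq V] (K : AbstractSimplicialComplex V)
    (a : ℕ) : (Chains K ⊗[ℤ] Chains K) →ₗ[ℤ] (Chains K ⊗[ℤ] Chains K) :=
  TensorProduct.map (boundary K a) LinearMap.id + TensorProduct.map (signOp K) (coboundary K)

/-- `T^n(N)`, the sum of the `N^{p,q}` with `q - p = n`. -/
def totalGroup {V : Type u} [DecidableEq V] (K : AbstractSimplicialComplex V) (a : ℕ) (n : ℤ) :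
    Submodule ℤ (Chains K ⊗[ℤ] Chains K) :=
  ⨆ p : ℤ, doubleGroup K a p (p + n)

section aux

variable {V : Type u} [Fintype V] [DecidableEq V] {K : AbstractSimplicialComplex V}

theorem doubleDiff_comp_doubleDiff (a : ℕ) : doubleDiff K a ∘ₗ doubleDiff K a = 0 := by
  refine TensorProduct.ext' fun x y => ?_
  have h1 := LinearMap.congr_fun (boundary_comp_boundary (K := K) a) x
  have h2 := LinearMap.congr_fun (coboundary_comp_coboundary (K := K)) y
  rw [LinearMap.comp_apply, LinearMap.zero_apply] at h1 h2
  simp only [doubleDiff, LinearMap.comp_apply, LinearMap.add_apply, TensorProduct.map_tmul,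
    LinearMap.id_apply, map_add, h1, h2, TensorProduct.zero_tmul, TensorProduct.tmul_zero,
    zero_add, add_zero, LinearMap.zero_apply]
  rw [← TensorProduct.add_tmul, add_comm, boundary_signOp, TensorProduct.zero_tmul]

theorem doubleDiff_mem {a : ℕ} {i j : ℤ} (hij : i + 1 = j) {x : Chains K ⊗[ℤ] Chains K}
    (hx : x ∈ totalGroup K a i) : doubleDiff K a x ∈ totalGroup K a j := by
  suffices h : totalGroup K a i ≤ (totalGroup K a j).comap (doubleDiff K a) from h hx
  refine iSup_le fun p => ?_
  rw [doubleGroup, Submodule.span_le]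
  rintro _ ⟨s, t, ha, hs, ht, hst, rfl⟩
  rw [SetLike.mem_coe, Submodule.mem_comap, doubleDiff, LinearMap.add_apply,
    TensorProduct.map_tmul, TensorProduct.map_tmul]
  refine Submodule.add_mem _ ?_ ?_
  · by_cases h : IsFace K s.toFinset ∧ a < s.length
    · rw [boundary_simplex a s h.1 h.2, TensorProduct.sum_tmul]
      refine Submodule.sum_mem _ fun k hk => ?_
      have hle := List.length_eraseIdx_of_lt (Finset.mem_range.1 hk)
      rw [← TensorProduct.smul_tmul']
      refine Submodule.smul_mem _ _ (Submodule.mem_iSup_of_mem (p - 1) (Submodule.subset_span ?_))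
      exact ⟨s.eraseIdx k, t, by omega, by omega, by omega,
        fun y hy => hst (List.mem_of_mem_eraseIdx hy), rfl⟩
    · rw [boundary_mk_single, if_neg h, TensorProduct.zero_tmul]
      exact Submodule.zero_mem _
  · rw [signOp_simplex, coboundary_simplex, TensorProduct.tmul_sum]
    refine Submodule.sum_mem _ fun v _ => ?_
    rw [← TensorProduct.smul_tmul']
    refine Submodule.smul_mem _ _ (Submodule.mem_iSup_of_mem p (Submodule.subset_span ?_))
    exact ⟨s, v :: t, ha, hs, by rw [List.length_cons]; push_cast; omega,
      fun y hy => List.mem_cons_of_mem _ (hst hy), rfl⟩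

end aux

/-- The total complex `(T^*(N), Δ)`. -/
def totalComplex {V : Type u} [Fintype V] [DecidableEq V] (K : AbstractSimplicialComplex V)
    (a : ℕ) : CochainComplex (ModuleCat.{u} ℤ) ℤ :=
  complexOfEnd (ComplexShape.up ℤ) (doubleDiff K a) (totalGroup K a)
    (fun _ _ h _ hx => doubleDiff_mem h hx) (doubleDiff_comp_doubleDiff a)

/-- The dual `Hom(C, R)` of a cochain complex, with the transposed differentials. -/
def dualComplex {R : Type} [CommRing R] (C : CochainComplex (ModuleCat.{u} R) ℤ) :
    ChainComplex (ModuleCat.{u} R) ℤ where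
  X n := ModuleCat.of R (Module.Dual R (C.X n))
  d i j := ModuleCat.ofHom (C.d j i).hom.dualMap
  shape i j h := by
    rw [C.shape j i h]
    ext f x
    exact map_zero (f : C.X i →ₗ[R] R)
  d_comp_d' i j k _ _ := by
    ext f x
    have h := ConcreteCategory.congr_hom (C.d_comp_d k j i) x
    exact (congrArg (f : C.X i →ₗ[R] R) h).trans (map_zero (f : C.X i →ₗ[R] R))

/-- The total complex `(T_*(N), D)` of the dual double complex. -/
def dualTotalComplex {V : Type u} [Fintype V] [DecidableEq V] (K : AbstractSimplicialComplex V)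
    (a : ℕ) : ChainComplex (ModuleCat.{u} ℤ) ℤ :=
  dualComplex (totalComplex K a)

/-! ## The spectral sequence of a filtered complex

The filtrations `F` are decreasing: `F s n` is the `s`-th step in degree `n`. -/

section SpectralSequence

variable {R : Type} [CommRing R] {c : ComplexShape ℤ}
  (C : HomologicalComplex (ModuleCat.{u} R) c)

/-- A family of subgroups of the terms of a complex, indexed by the step and the degree. -/
abbrev Filtration : Type u :=
  ℤ → ∀ n : ℤ, Submodule R (C.X n)

variable (F : Filtration C)

/-- `Z_r^s = {x ∈ F^s | d x ∈ F^{s+r}}` in degree `n`. -/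
def approxCycles (r s n : ℤ) : Submodule R (C.X n) :=
  F s n ⊓ ⨅ m : ℤ, (F (s + r) m).comap (C.d n m).hom

/-- `Z_{r-1}^{s+1} + d Z_{r-1}^{s-r+1}` in degree `n`. -/
def approxBoundaries (r s n : ℤ) : Submodule R (C.X n) :=
  approxCycles C F (r - 1) (s + 1) n ⊔
    ⨆ m : ℤ, (approxCycles C F (r - 1) (s - r + 1) m).map (C.d m n).hom

/-- The term `E_r^s = Z_r^s / (Z_{r-1}^{s+1} + d Z_{r-1}^{s-r+1})`, `r ≥ 1`, in total
degree `n`. -/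
abbrev page (r s n : ℤ) : Type u :=
  approxCycles C F r s n ⧸ (approxBoundaries C F r s n).submoduleOf (approxCycles C F r s n)

theorem d_mem_approxCycles (r s n m : ℤ) (x : C.X n) (hx : x ∈ approxCycles C F r s n) :
    (C.d n m).hom x ∈ approxCycles C F r (s + r) m := by
  refine ⟨(Submodule.mem_iInf _).1 hx.2 m, (Submodule.mem_iInf _).2 fun k => ?_⟩
  rw [Submodule.mem_comap]
  have h : (C.d m k).hom ((C.d n m).hom x) = 0 :=
    ConcreteCategory.congr_hom (C.d_comp_d n m k) x
  rw [h]
  exact Submodule.zero_mem _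

theorem d_mem_approxBoundaries (r s n m : ℤ) (x : C.X n) (hx : x ∈ approxBoundaries C F r s n) :
    (C.d n m).hom x ∈ approxBoundaries C F r (s + r) m := by
  suffices h : approxBoundaries C F r s n ≤
      (approxBoundaries C F r (s + r) m).comap (C.d n m).hom from h hx
  refine sup_le (fun y hy => ?_) (iSup_le fun k => ?_)
  · refine Submodule.mem_sup_right (Submodule.mem_iSup_of_mem n ?_)
    rw [add_sub_cancel_right]
    exact Submodule.mem_map_of_mem hy
  · rintro _ ⟨y, _, rfl⟩
    rw [Submodule.mem_comap]
    have h : (C.d n m).hom ((C.d k n).hom y) = 0 :=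
      ConcreteCategory.congr_hom (C.d_comp_d k n m) y
    rw [h]
    exact Submodule.zero_mem _

/-- The component `E_r^s → E_r^{s+r}` of the differential of the `r`-th page, from total degree
`n` to total degree `m`, induced by that of the complex. -/
def pageDiff (r s n m : ℤ) : page C F r s n →ₗ[R] page C F r (s + r) m :=
  Submodule.mapQ _ _ ((C.d n m).hom.restrict (d_mem_approxCycles C F r s n m))
    (fun x hx => d_mem_approxBoundaries C F r s n m x hx)

/-- The spectral sequence converges to the graded group `H`: each `H n` has a finite decreasing
filtration `Φ`, and for each `s` and all large `r`, the differentials of the `r`-th page from and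
to `E_r^s` vanish in degree `n` and `E_r^s ≅ Φ^s / Φ^{s+1}`. -/
def ConvergesTo (H : ℤ → ModuleCat.{u} R) : Prop :=
  ∀ n : ℤ, ∃ Φ : ℤ → Submodule R (H n), Antitone Φ ∧ (∃ s, Φ s = ⊤) ∧ (∃ s, Φ s = ⊥) ∧
    ∀ s : ℤ, ∃ r₀ : ℤ, 1 ≤ r₀ ∧ ∀ r : ℤ, r₀ ≤ r →
      (∀ m : ℤ, pageDiff C F r s n m = 0) ∧
      (∀ s' m : ℤ, s' + r = s → pageDiff C F r s' m n = 0) ∧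
      Nonempty (page C F r s n ≃ₗ[R] (Φ s ⧸ (Φ (s + 1)).submoduleOf (Φ s)))

end SpectralSequence

/-! ## The cohomeology and homeology spectral sequences -/

/-- The filtration of `T^*(N(K))` by the `F^p = ⨁_{i ≤ p} N^{i,*}(K)`, placed in step `s = -p`.
The term `E_r^{p,q}(K)` of its spectral sequence is `page _ _ r (-p) (q - p)`, and the
differential goes to `E_r^{p-r,q-r+1}(K)`. -/
def cohomeologyFiltration {V : Type u} [Fintype V] [DecidableEq V]
    (K : AbstractSimplicialComplex V) : Filtration (totalComplex K 1) := fun s n =>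
  (⨆ i : ℤ, ⨆ _ : i ≤ -s, doubleGroup K 1 i (i + n)).submoduleOf (totalGroup K 1 n)

/-- The filtration of `T_*(N(K))` by the `F_p = ⨁_{i ≥ p} N_{i,*}(K)`, that is, by the
functionals on `N^{*,*}(K)` that vanish on `N^{i,*}(K)` for all `i < p`. The term `E^r_{p,q}(K)`
of its spectral sequence is `page _ _ r p (q - p)`, and the differential goes to
`E^r_{p+r,q+r-1}(K)`. -/
def homeologyFiltration {V : Type u} [Fintype V] [DecidableEq V]
    (K : AbstractSimplicialComplex V) : Filtration (dualTotalComplex K 1) := fun p n =>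
  ((⨆ i : ℤ, ⨆ _ : i < p, doubleGroup K 1 i (i + n)).submoduleOf
    (totalGroup K 1 n)).dualAnnihilator

end Homeology

end

/-! Fix a simplex τ. The elements σ ⊗ τ with σ ⊆ τ form a column of the double complex, and this
column is the chain complex of the full simplex on τ. The cone `h` from a chosen vertex b(τ)
contracts it, by d(v·σ) = σ - v·dσ. In the unreduced case a copy of ℤ survives in each column,
generated by b(τ) ⊗ τ, and together these copies form C^*(K). In the reduced case every column with
τ ≠ ∅ is contractible and only ∅ ⊗ ∅ survives.

The passage from columns to the total complex is a perturbation argument (`nonempty_homotopyEquiv`).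
Let ε map the double complex onto what survives and put θ = 1 - Δh - hΔ. On the kernel of ε the
column part of Δh + hΔ is the identity, so θ there is minus the anticommutator of `h` with the row
differential and lengthens τ. Since no simplex has more than |V| vertices, a power of θ kills ker ε.
That power is homotopic to the identity and factors through ε, so ε is a homotopy equivalence
(`nonempty_totalComplex_homotopyEquiv`, with its two instances
`nonempty_homotopyEquiv_cochainComplex` and `nonempty_homotopyEquiv_integerComplex`).

Homotopy equivalences survive transposition (`dualHomotopyEquiv`), so the dual statements need only
the duals of the small complexes. The dual of C^*(K) is C_*(K) because d and δ are adjoint for the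
pairing in which oriented simplices are orthonormal (`pairing_boundary`, `pairingMap_bijective`,
`chainComplexIso`).

Convergence is the general fact for bounded filtrations (`convergesTo_of_bounded`): the double
complex vanishes outside 0 ≤ p < |V|. -/

noncomputable section

namespace Homeology

universe u

set_option linter.unusedSectionVars false

/-! ### Homology by elements, and convergence for bounded filtrations. -/

section FilteredComplex

variable {R : Type} [CommRing R] {c : ComplexShape ℤ} (C : HomologicalComplex (ModuleCat.{u} R) c)

/-- The cycles of degree `n`, as a submodule. -/
def cycleSubmodule (n : ℤ) : Submodule R (C.X n) :=
  ⨅ m : ℤ, LinearMap.ker (C.d n m).hom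

theorem mem_cycleSubmodule {n : ℤ} {x : C.X n} :
    x ∈ cycleSubmodule C n ↔ ∀ m, (C.d n m).hom x = 0 := by
  simp [cycleSubmodule, Submodule.mem_iInf]

/-- An elementwise description of the homology object: a surjection from the cycles whose kernel is
the boundaries. Letting the target or source degree range over all integers is harmless, since
differentials between unrelated degrees are zero. -/
theorem exists_homologyProj (n : ℤ) :
    ∃ p : cycleSubmodule C n →ₗ[R] C.homology n, Function.Surjective p ∧
      ∀ x, p x = 0 ↔ ∃ (m : ℤ) (y : C.X m), (C.d m n).hom y = x := by
  have hle : cycleSubmodule C n ≤ LinearMap.ker (C.sc n).g.hom := fun x hx =>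
    (mem_cycleSubmodule C).1 hx _
  let e : (LinearMap.ker (C.sc n).g.hom ⧸ LinearMap.range (C.sc n).moduleCatToCycles) ≃ₗ[R]
      C.homology n := (C.sc n).moduleCatHomologyIso.symm.toLinearEquiv
  refine ⟨e.toLinearMap ∘ₗ
    (LinearMap.range (C.sc n).moduleCatToCycles).mkQ ∘ₗ Submodule.inclusion hle, ?_, ?_⟩
  · refine e.surjective.comp ((Submodule.mkQ_surjective _).comp ?_)
    rintro ⟨x, hx⟩
    refine ⟨⟨x, (mem_cycleSubmodule C).2 fun m => ?_⟩, rfl⟩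
    by_cases h : c.Rel n m
    · obtain rfl := c.next_eq' h
      exact hx
    · rw [C.shape n m h]; rfl
  · intro x
    rw [LinearMap.comp_apply, LinearEquiv.coe_coe, LinearEquiv.map_eq_zero_iff]
    refine (Submodule.Quotient.mk_eq_zero _).trans ?_
    constructor
    · rintro ⟨y, hy⟩
      exact ⟨_, y, congrArg Subtype.val hy⟩
    · rintro ⟨m, y, hy⟩
      by_cases h : c.Rel m n
      · obtain rfl := c.prev_eq' h
        exact ⟨y, Subtype.ext hy⟩
      · rw [C.shape m n h] at hy
        refine ⟨0, ?_⟩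
        rw [map_zero]
        exact Subtype.ext hy

variable (F : Filtration C)

theorem approxCycles_eq_of_bot {r s n : ℤ} (h : ∀ m, F (s + r) m = ⊥) :
    approxCycles C F r s n = F s n ⊓ cycleSubmodule C n := by
  simp only [approxCycles, cycleSubmodule, h]
  rfl

/-- For `r` large, the term `E_r^s` is the `s`-th graded piece of the homology. -/
theorem nonempty_pageEquiv (hF : ∀ n, Antitone fun s => F s n) {r s n : ℤ}
    (htop : ∀ m, F (s - r + 1) m = ⊤) (hbot : ∀ m, F (s + r) m = ⊥)
    (p : cycleSubmodule C n →ₗ[R] C.homology n)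
    (hp : ∀ x, p x = 0 ↔ ∃ (m : ℤ) (y : C.X m), (C.d m n).hom y = x)
    (Φ : ℤ → Submodule R (C.homology n))
    (hΦ : ∀ s, Φ s = ((F s n).submoduleOf (cycleSubmodule C n)).map p) :
    Nonempty (page C F r s n ≃ₗ[R] (Φ s ⧸ (Φ (s + 1)).submoduleOf (Φ s))) := by
  have hZ : approxCycles C F r s n = F s n ⊓ cycleSubmodule C n := approxCycles_eq_of_bot C F hbot
  have hZ' : approxCycles C F (r - 1) (s + 1) n = F (s + 1) n ⊓ cycleSubmodule C n :=
    approxCycles_eq_of_bot C F fun m => by rw [← hbot m]; congr 1; ring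
  let q : approxCycles C F r s n →ₗ[R] Φ s :=
    (p ∘ₗ Submodule.inclusion (hZ.le.trans inf_le_right)).codRestrict (Φ s) fun x => by
      rw [hΦ]
      exact ⟨_, (hZ.le x.2).1, rfl⟩
  have hq : Function.Surjective q := by
    rintro ⟨z, hz⟩
    obtain ⟨x, hx, rfl⟩ := (hΦ s).le hz
    exact ⟨⟨x, hZ.ge ⟨hx, x.2⟩⟩, rfl⟩
  -- The denominator of E_r^s is exactly what dies in the graded piece. If the class of x is also
  -- represented by y ∈ F^{s+1}, then x - y = dw, and w lies in Z_{r-1}^{s-r+1} automatically: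
  -- F^{s-r+1} is everything and dw ∈ F^s.
  have hker : LinearMap.ker (((Φ (s + 1)).submoduleOf (Φ s)).mkQ ∘ₗ q) =
      (approxBoundaries C F r s n).submoduleOf (approxCycles C F r s n) := by
    ext x
    rw [LinearMap.mem_ker, LinearMap.comp_apply, Submodule.mkQ_apply,
      Submodule.Quotient.mk_eq_zero, Submodule.submoduleOf, Submodule.mem_comap,
      Submodule.submoduleOf, Submodule.mem_comap, hΦ (s + 1), Submodule.subtype_apply,
      Submodule.subtype_apply]
    constructor
    · rintro ⟨y, hy, hyx⟩
      have hxc : (x : C.X n) ∈ cycleSubmodule C n := (hZ.le x.2).2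
      have h0 : p (⟨x, hxc⟩ - y) = 0 := by
        rw [map_sub, hyx]
        exact sub_self _
      obtain ⟨m, w, hw⟩ := (hp _).1 h0
      by_cases hmn : c.Rel m n
      · have hw' : (x : C.X n) = y + (C.d m n).hom w := by rw [hw]; simp
        rw [hw']
        refine Submodule.add_mem_sup (hZ'.ge ⟨hy, y.2⟩) (Submodule.mem_iSup_of_mem m
          (Submodule.mem_map_of_mem ⟨(htop m).ge trivial, (Submodule.mem_iInf _).2 fun k => ?_⟩))
        rw [Submodule.mem_comap]
        by_cases hmk : c.Rel m k
        · obtain rfl := c.next_eq hmk hmn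
          rw [show s - r + 1 + (r - 1) = s by ring, hw]
          exact Submodule.sub_mem _ (hZ.le x.2).1 (hF _ (by simp) hy)
        · rw [C.shape m k hmk]
          exact Submodule.zero_mem _
      · rw [C.shape m n hmn] at hw
        have hxy : (x : C.X n) = y := (sub_eq_zero.1 hw.symm)
        rw [hxy]
        exact Submodule.mem_sup_left (hZ'.ge ⟨hy, y.2⟩)
    · intro hx
      obtain ⟨y, hy, z, hz, hyz⟩ := Submodule.mem_sup.1 hx
      have hle : ⨆ m : ℤ, (approxCycles C F (r - 1) (s - r + 1) m).map (C.d m n).hom ≤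
          (LinearMap.ker p).map (cycleSubmodule C n).subtype := by
        refine iSup_le fun m => ?_
        rintro _ ⟨w, _, rfl⟩
        have hc : (C.d m n).hom w ∈ cycleSubmodule C n := (mem_cycleSubmodule C).2 fun k =>
          ConcreteCategory.congr_hom (C.d_comp_d m n k) w
        exact ⟨⟨_, hc⟩, (hp _).2 ⟨m, w, rfl⟩, rfl⟩
      obtain ⟨z', hz', rfl⟩ := hle hz
      obtain ⟨hy1, hy2⟩ := hZ'.le hy
      refine ⟨⟨y, hy2⟩, hy1, ?_⟩
      have h1 : Submodule.inclusion (hZ.le.trans inf_le_right) x = ⟨y, hy2⟩ + z' :=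
        Subtype.ext hyz.symm
      change p ⟨y, hy2⟩ = p (Submodule.inclusion (hZ.le.trans inf_le_right) x)
      rw [h1, map_add, LinearMap.mem_ker.1 hz', add_zero]
  exact ⟨(Submodule.quotEquivOfEq _ _ hker.symm).trans
    (LinearMap.quotKerEquivOfSurjective _ ((Submodule.mkQ_surjective _).comp hq))⟩

theorem convergesTo_of_bounded (hF : ∀ n, Antitone fun s => F s n) {a b : ℤ}
    (htop : ∀ s n, s ≤ a → F s n = ⊤) (hbot : ∀ s n, b ≤ s → F s n = ⊥)
    {H : ℤ → ModuleCat.{u} R} (e : ∀ n, C.homology n ≅ H n) : ConvergesTo C F H := by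
  intro n
  obtain ⟨p, hps, hp⟩ := exists_homologyProj C n
  let Φ : ℤ → Submodule R (C.homology n) := fun s =>
    ((F s n).submoduleOf (cycleSubmodule C n)).map p
  let E : C.homology n ≃ₗ[R] H n := (e n).toLinearEquiv
  refine ⟨fun s => (Φ s).map E.toLinearMap, fun s t hst => Submodule.map_mono
    (Submodule.map_mono (Submodule.comap_mono (hF n hst))), ⟨a, ?_⟩, ⟨b, ?_⟩, fun s => ?_⟩
  · simp only [Φ, htop a n le_rfl, Submodule.submoduleOf, Submodule.comap_top, Submodule.map_top,
      LinearMap.range_eq_top.2 hps, LinearEquiv.range]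
  · simp only [Φ, hbot b n le_rfl, Submodule.submoduleOf, Submodule.comap_bot,
      Submodule.ker_subtype, Submodule.map_bot]
  -- The bound b - s makes F^{s+r} zero, which kills outgoing differentials; the bound s + 1 - a
  -- makes F^{s-r+1} everything, which kills incoming ones.
  · refine ⟨max 1 (max (b - s) (s + 1 - a)), le_max_left _ _, fun r hr => ?_⟩
    obtain ⟨hr1, hr2, hr3⟩ : 1 ≤ r ∧ b - s ≤ r ∧ s + 1 - a ≤ r := by
      simpa only [max_le_iff] using hr
    refine ⟨fun m => ?_, fun s' m hs' => ?_, ?_⟩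
    · refine LinearMap.ext fun x => ?_
      obtain ⟨x, rfl⟩ := Submodule.Quotient.mk_surjective _ x
      refine (Submodule.Quotient.mk_eq_zero _).2 ?_
      have h := (d_mem_approxCycles C F r s n m x x.2).1
      rw [hbot (s + r) m (by omega)] at h
      replace h : (C.d n m).hom x = 0 := h
      change (C.d n m).hom x ∈ approxBoundaries C F r (s + r) m
      rw [h]
      exact Submodule.zero_mem _
    · refine LinearMap.ext fun x => ?_
      obtain ⟨x, rfl⟩ := Submodule.Quotient.mk_surjective _ x
      -- The source x lies in F^{s'+1} because that step is everything, so dx already belongs to the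
      -- denominator of the target.
      refine (Submodule.Quotient.mk_eq_zero _).2
        (Submodule.mem_sup_right (Submodule.mem_iSup_of_mem m
          (Submodule.mem_map_of_mem ⟨?_, ?_⟩)))
      · rw [htop _ m (by omega)]
        trivial
      · rw [show s' + r - r + 1 + (r - 1) = s' + r by ring]
        exact x.2.2
    · obtain ⟨f⟩ := nonempty_pageEquiv C F hF (fun m => htop (s - r + 1) m (by omega))
        (fun m => hbot (s + r) m (by omega)) p hp Φ (fun _ => rfl)
      refine ⟨f.trans (Submodule.Quotient.equiv _ _ (E.submoduleMap (Φ s)) ?_)⟩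
      ext ⟨y, hy⟩
      constructor
      · rintro ⟨x, hx, hxy⟩
        exact ⟨x, hx, congrArg Subtype.val hxy⟩
      · rintro ⟨x, hx, hxy⟩
        obtain ⟨x', hx', rfl⟩ := hy
        obtain rfl : x = x' := E.injective hxy
        exact ⟨⟨x, hx'⟩, hx, rfl⟩

end FilteredComplex

/-! ### Homotopy equivalences from contractions up to nilpotents. -/

section Contraction

variable {R : Type} [CommRing R] {A B : Type u} [AddCommGroup A] [Module R A] [AddCommGroup B]
  [Module R B] {c : ComplexShape ℤ} {D : A →ₗ[R] A} {G : ℤ → Submodule R A}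
  (hG : ∀ i j, c.Rel i j → ∀ x ∈ G i, D x ∈ G j) (hD : D ∘ₗ D = 0)
  {D' : B →ₗ[R] B} {G' : ℤ → Submodule R B}
  (hG' : ∀ i j, c.Rel i j → ∀ x ∈ G' i, D' x ∈ G' j) (hD' : D' ∘ₗ D' = 0)

theorem complexOfEnd_d {i j : ℤ} (h : c.Rel i j) :
    (complexOfEnd c D G hG hD).d i j = ModuleCat.ofHom (D.restrict (hG i j h)) :=
  dif_pos h

/-- The chain map induced by a linear map. -/
def complexOfEndMap (f : A →ₗ[R] B) (hf : ∀ n, ∀ x ∈ G n, f x ∈ G' n)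
    (hfD : ∀ n, ∀ x ∈ G n, D' (f x) = f (D x)) :
    complexOfEnd c D G hG hD ⟶ complexOfEnd c D' G' hG' hD' where
  f n := ModuleCat.ofHom (f.restrict (hf n))
  comm' i j hij := by
    rw [complexOfEnd_d _ _ hij, complexOfEnd_d _ _ hij]
    ext x
    exact Subtype.ext (hfD i (x : G i).1 (x : G i).2)

open Classical in
/-- The components of the homotopy induced by a linear map. -/
def complexOfEndHom (H : A →ₗ[R] B) (hH : ∀ i j, c.Rel j i → ∀ x ∈ G i, H x ∈ G' j) (i j : ℤ) :
    (complexOfEnd c D G hG hD).X i ⟶ (complexOfEnd c D' G' hG' hD').X j :=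
  if h : c.Rel j i then ModuleCat.ofHom (H.restrict (hH i j h)) else 0

theorem complexOfEndHom_of_rel (H : A →ₗ[R] B)
    (hH : ∀ i j, c.Rel j i → ∀ x ∈ G i, H x ∈ G' j) {i j : ℤ} (h : c.Rel j i) :
    complexOfEndHom hG hD hG' hD' H hH i j = ModuleCat.ofHom (H.restrict (hH i j h)) :=
  dif_pos h

/-- The homotopy induced by a linear map. -/
def complexOfEndHomotopy
    {hG : ∀ i j, (ComplexShape.up ℤ).Rel i j → ∀ x ∈ G i, D x ∈ G j} {hD : D ∘ₗ D = 0}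
    {hG' : ∀ i j, (ComplexShape.up ℤ).Rel i j → ∀ x ∈ G' i, D' x ∈ G' j} {hD' : D' ∘ₗ D' = 0}
    {f g : complexOfEnd (ComplexShape.up ℤ) D G hG hD ⟶
      complexOfEnd (ComplexShape.up ℤ) D' G' hG' hD'}
    (H : A →ₗ[R] B) (hH : ∀ i j, (ComplexShape.up ℤ).Rel j i → ∀ x ∈ G i, H x ∈ G' j)
    (hfg : ∀ n, ∀ x : G n,
      ((f.f n).hom x : G' n).1 = H (D x) + D' (H x) + ((g.f n).hom x : G' n).1) :
    Homotopy f g where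
  hom := complexOfEndHom hG hD hG' hD' H hH
  zero i j h := dif_neg h
  comm n := by
    have h1 : (ComplexShape.up ℤ).Rel n (n + 1) := rfl
    have h2 : (ComplexShape.up ℤ).Rel (n - 1) n := sub_add_cancel n 1
    rw [dNext_eq _ h1, prevD_eq _ h2, complexOfEndHom_of_rel _ _ _ _ _ _ h1,
      complexOfEndHom_of_rel _ _ _ _ _ _ h2, complexOfEnd_d _ _ h1,
      complexOfEnd_d _ _ h2]
    ext x
    exact Subtype.ext (hfg n x)

/-- A surjective chain map `ε` with a section `s` is a homotopy equivalence if there is an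
operator `h` of degree `-1` with `ε h = 0` such that `1 - D h - h D` is nilpotent on the
kernel of `ε`. -/
theorem nonempty_homotopyEquiv
    (hG : ∀ i j, (ComplexShape.up ℤ).Rel i j → ∀ x ∈ G i, D x ∈ G j)
    (hG' : ∀ i j, (ComplexShape.up ℤ).Rel i j → ∀ x ∈ G' i, D' x ∈ G' j)
    (ε : A →ₗ[R] B) (s : B →ₗ[R] A) (h : A →ₗ[R] A)
    (hε : ∀ n, ∀ x ∈ G n, ε x ∈ G' n) (hεD : ∀ n, ∀ x ∈ G n, D' (ε x) = ε (D x))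
    (hs : ∀ n, ∀ x ∈ G' n, s x ∈ G n) (hεs : ∀ n, ∀ x ∈ G' n, ε (s x) = x)
    (hh : ∀ i j, j + 1 = i → ∀ x ∈ G i, h x ∈ G j) (hεh : ∀ n, ∀ x ∈ G n, ε (h x) = 0)
    (M : ℕ)
    (hM : ∀ n, ∀ x ∈ G n, ε x = 0 → ((1 - D * h - h * D : Module.End R A) ^ M) x = 0) :
    Nonempty (HomotopyEquiv (complexOfEnd (ComplexShape.up ℤ) D G hG hD)
      (complexOfEnd (ComplexShape.up ℤ) D' G' hG' hD')) := by
  set θ : Module.End R A := 1 - D * h - h * D with hθ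
  have hDD : D * D = 0 := hD
  have hDθ : D * θ = θ * D := by
    simp only [hθ, mul_sub, sub_mul, ← mul_assoc, hDD, mul_one, one_mul, zero_mul]
    simp only [mul_assoc, hDD, mul_zero, sub_zero]
  have hDG : ∀ n, ∀ x ∈ G n, D x ∈ G (n + 1) := fun n => hG n (n + 1) rfl
  have hhG : ∀ n, ∀ x ∈ G n, h x ∈ G (n - 1) := fun n => hh n (n - 1) (by ring)
  have hθG : ∀ n, ∀ x ∈ G n, θ x ∈ G n := fun n x hx => by
    refine Submodule.sub_mem _ (Submodule.sub_mem _ hx ?_) ?_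
    · exact hG (n - 1) n (sub_add_cancel n 1) _ (hhG n x hx)
    · exact hh (n + 1) n rfl _ (hDG n x hx)
  have hθk : ∀ k : ℕ, ∀ n, ∀ x ∈ G n, (θ ^ k) x ∈ G n := fun k => by
    induction k with
    | zero => exact fun n x hx => hx
    | succ k ih => exact fun n x hx => by rw [pow_succ']; exact hθG n _ (ih n x hx)
  -- Both correction terms vanish under ε: ε h = 0 directly, and ε D h = D' ε h.
  have hεθ : ∀ n, ∀ x ∈ G n, ε (θ x) = ε x := fun n x hx => by
    simp only [hθ, LinearMap.sub_apply, Module.End.one_apply, Module.End.mul_apply, map_sub]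
    rw [← hεD _ _ (hhG n x hx), hεh n x hx, hεh _ _ (hDG n x hx)]
    simp
  have hεθk : ∀ k : ℕ, ∀ n, ∀ x ∈ G n, ε ((θ ^ k) x) = ε x := fun k => by
    induction k with
    | zero => exact fun n x hx => rfl
    | succ k ih =>
        intro n x hx
        rw [pow_succ', Module.End.mul_apply, hεθ n _ (hθk k n x hx), ih n x hx]
  -- Since x - s(ε x) lies in ker ε, the value of θ^M at x depends only on ε x.
  have hker : ∀ n, ∀ x ∈ G n, (θ ^ M) (s (ε x)) = (θ ^ M) x := fun n x hx => by
    have h0 : ε (x - s (ε x)) = 0 := by rw [map_sub, hεs n _ (hε n x hx), sub_self]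
    have := hM n _ (Submodule.sub_mem _ hx (hs n _ (hε n x hx))) h0
    rw [map_sub, sub_eq_zero] at this
    exact this.symm
  have hDθM : ∀ x, D ((θ ^ M) x) = (θ ^ M) (D x) := fun x =>
    LinearMap.congr_fun ((show Commute D θ from hDθ).pow_right M).eq x
  set S : Module.End R A := ∑ k ∈ Finset.range M, θ ^ k with hS
  have hDS : D * S = S * D :=
    (Commute.sum_right _ _ _ fun k _ => (show Commute D θ from hDθ).pow_right k).eq
  have hSG : ∀ n, ∀ x ∈ G n, S x ∈ G n := fun n x hx => by
    rw [hS, LinearMap.sum_apply]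
    exact Submodule.sum_mem _ fun k _ => hθk k n x hx
  -- The geometric sum S turns the homotopy `h` between 1 and θ into a homotopy `h * S` between 1
  -- and θ^M.
  have hsum : h * S * D + D * (h * S) = 1 - θ ^ M := by
    have h1 : (1 - θ) * S = 1 - θ ^ M := mul_neg_geom_sum θ M
    have h2 : 1 - θ = D * h + h * D := by rw [hθ]; abel
    rw [← h1, h2, add_mul, mul_assoc, ← hDS]
    simp only [mul_assoc]
    abel
  let F := complexOfEndMap hG hD hG' hD' ε hε hεD
  -- The section s need not commute with the differentials, but θ^M ∘ s does: D(s x) and s(D' x)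
  -- have the same image under ε, hence under θ^M.
  let I := complexOfEndMap hG' hD' hG hD ((θ ^ M) ∘ₗ s) (fun n x hx => hθk M n _ (hs n x hx))
    (fun n x hx => by
      have hx' := hs n x hx
      have h1 : D' x = ε (D (s x)) := by rw [← hεD n _ hx', hεs n x hx]
      rw [LinearMap.comp_apply, hDθM, LinearMap.comp_apply, h1, hker _ _ (hDG n _ hx')])
  refine ⟨⟨F, I, (complexOfEndHomotopy (h * S) ?_ ?_).symm, Homotopy.ofEq ?_⟩⟩
  · exact fun i j hij x hx => hh i j hij _ (hSG i x hx)
  · intro n x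
    have h1 := LinearMap.congr_fun hsum x
    change (x : A) = (h * S) (D x) + D ((h * S) x) + (θ ^ M) (s (ε x))
    rw [hker n x x.2]
    exact eq_add_of_sub_eq h1.symm
  · ext n : 1
    refine ModuleCat.hom_ext (LinearMap.ext fun x => Subtype.ext ?_)
    change ε ((θ ^ M) (s (x : G' n).1)) = (x : G' n).1
    rw [hεθk M n _ (hs n _ (x : G' n).2), hεs n _ (x : G' n).2]

end Contraction

/-! ### Transposes of chain maps and homotopies. -/

section Dual

variable {R : Type} [CommRing R] {C C' : CochainComplex (ModuleCat.{u} R) ℤ}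

/-- The transpose of a homomorphism between terms. -/
def dualHom {i j : ℤ} (f : C.X j ⟶ C'.X i) : (dualComplex C').X i ⟶ (dualComplex C).X j :=
  ModuleCat.ofHom f.hom.dualMap

/-- The transpose of a chain map. -/
def dualMap (f : C ⟶ C') : dualComplex C' ⟶ dualComplex C where
  f n := dualHom (f.f n)
  comm' i j _ := by
    refine ModuleCat.hom_ext (LinearMap.ext fun (φ : C'.X i →ₗ[R] R) =>
      LinearMap.ext fun (x : C.X j) => ?_)
    exact (congrArg φ (ConcreteCategory.congr_hom (f.comm j i) x)).symm

/-- The transpose of a homotopy. -/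
def dualHomotopy {f g : C ⟶ C'} (H : Homotopy f g) : Homotopy (dualMap f) (dualMap g) where
  hom i j := dualHom (H.hom j i)
  zero i j h := by
    rw [H.zero j i h]
    refine ModuleCat.hom_ext (LinearMap.ext fun (φ : C'.X i →ₗ[R] R) =>
      LinearMap.ext fun (x : C.X j) => ?_)
    exact map_zero φ
  comm n := by
    have h1 : (ComplexShape.up ℤ).Rel n (n + 1) := rfl
    have h2 : (ComplexShape.up ℤ).Rel (n - 1) n := sub_add_cancel n 1
    have h3 : (ComplexShape.down ℤ).Rel (n + 1) n := rfl
    have h4 : (ComplexShape.down ℤ).Rel n (n - 1) := sub_add_cancel n 1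
    have h := H.comm n
    rw [dNext_eq _ h1, prevD_eq _ h2] at h
    rw [dNext_eq _ h4, prevD_eq _ h3]
    refine ModuleCat.hom_ext (LinearMap.ext fun (φ : C'.X n →ₗ[R] R) =>
      LinearMap.ext fun (x : C.X n) => ?_)
    have hx := ConcreteCategory.congr_hom h x
    refine (congrArg φ hx).trans ?_
    -- Transposition reverses composition, so the two homotopy terms trade places.
    change φ ((H.hom (n + 1) n).hom ((C.d n (n + 1)).hom x) +
      (C'.d (n - 1) n).hom ((H.hom n (n - 1)).hom x) + (g.f n).hom x) =
      φ ((C'.d (n - 1) n).hom ((H.hom n (n - 1)).hom x)) +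
      φ ((H.hom (n + 1) n).hom ((C.d n (n + 1)).hom x)) +
      φ ((g.f n).hom x)
    rw [map_add, map_add]
    abel

/-- The transpose of a homotopy equivalence. -/
def dualHomotopyEquiv (e : HomotopyEquiv C C') :
    HomotopyEquiv (dualComplex C') (dualComplex C) where
  hom := dualMap e.hom
  inv := dualMap e.inv
  homotopyHomInvId := dualHomotopy e.homotopyInvHomId
  homotopyInvHomId := dualHomotopy e.homotopyHomInvId

end Dual

/-! ### Homology of a complex with zero differential. -/

section ZeroDifferential

variable {R : Type} [CommRing R] {c : ComplexShape ℤ} {C : HomologicalComplex (ModuleCat.{u} R) c}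

theorem nonempty_homologyEquiv_of_d_eq_zero {n : ℤ} (h : ∀ i j, C.d i j = 0) :
    Nonempty (C.homology n ≃ₗ[R] C.X n) := by
  obtain ⟨p, hp, hp0⟩ := exists_homologyProj C n
  have hinj : Function.Injective p := by
    rw [injective_iff_map_eq_zero]
    intro x hx
    obtain ⟨m, y, hy⟩ := (hp0 x).1 hx
    rw [h] at hy
    exact Subtype.ext hy.symm
  have htop : cycleSubmodule C n = ⊤ := by
    rw [eq_top_iff]
    intro x _
    rw [mem_cycleSubmodule]
    intro m
    rw [h]
    rfl
  exact ⟨(LinearEquiv.ofBijective p ⟨hinj, hp⟩).symm.trans (LinearEquiv.ofTop _ htop)⟩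

end ZeroDifferential

/-! ### Cone contraction of the columns. -/

section Columns

variable {V : Type u} [DecidableEq V] {K : AbstractSimplicialComplex V}

theorem isFace_of_length_le_one {l : List V} (h : l.length ≤ 1) : IsFace K l.toFinset := by
  match l, h with
  | [], _ => exact Or.inl rfl
  | [v], _ => exact Or.inr (K.singleton_mem v)

/-- The integer-valued functional induced by an alternating function on sequences. -/
def chainFunctional (f : List V → ℤ)
    (hadj : ∀ (l m : List V) (a b : V), f (l ++ a :: b :: m) + f (l ++ b :: a :: m) = 0)
    (hrep : ∀ (l m : List V) (a : V), f (l ++ a :: a :: m) = 0)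
    (hface : ∀ l : List V, ¬ IsFace K l.toFinset → f l = 0) : Chains K →ₗ[ℤ] ℤ :=
  -- The target of `chainLift` must live in the universe of V, so integer values pass through
  -- `ULift`.
  (ULift.moduleEquiv : ULift.{u} ℤ ≃ₗ[ℤ] ℤ).toLinearMap ∘ₗ
    chainLift (fun l => (ULift.up (f l) : ULift.{u} ℤ)) (lift_aux _
      (fun l m a b => congrArg ULift.up (hadj l m a b))
      (fun l m a => congrArg ULift.up (hrep l m a))
      (fun l hl => congrArg ULift.up (hface l hl)))

theorem chainFunctional_simplex (f : List V → ℤ)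
    (hadj : ∀ (l m : List V) (a b : V), f (l ++ a :: b :: m) + f (l ++ b :: a :: m) = 0)
    (hrep : ∀ (l m : List V) (a : V), f (l ++ a :: a :: m) = 0)
    (hface : ∀ l : List V, ¬ IsFace K l.toFinset → f l = 0) (l : List V) :
    chainFunctional f hadj hrep hface (simplex K l) = f l := by
  rw [chainFunctional, LinearMap.comp_apply, chainLift_simplex]
  rfl

theorem toFinset_swap (l m : List V) (a b : V) :
    (l ++ a :: b :: m).toFinset = (l ++ b :: a :: m).toFinset := by
  ext z; simp; tauto

/-- The linear map given on each simplex by a linear map that depends on its set of vertices. -/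
def supportLift {M : Type u} [AddCommGroup M] (Φ : Finset V → Chains K →ₗ[ℤ] M) :
    Chains K →ₗ[ℤ] M :=
  chainLift (fun l => Φ l.toFinset (simplex K l)) (by
    apply lift_aux
    · intro l m a b
      have h := simplex_swap (K := K) l [] m a b
      simp only [List.nil_append] at h
      rw [toFinset_swap, ← map_add, h, map_zero]
    · intro l m a
      rw [simplex_eq_zero (Or.inl fun h => ?_), map_zero]
      have h' := (List.nodup_append.1 h).2.1
      simp at h'
    · intro l hl
      rw [simplex_eq_zero (Or.inr hl), map_zero])

theorem supportLift_simplex {M : Type u} [AddCommGroup M] (Φ : Finset V → Chains K →ₗ[ℤ] M)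
    (l : List V) : supportLift Φ (simplex K l) = Φ l.toFinset (simplex K l) :=
  chainLift_simplex _ _ l

variable (K) in
/-- The indicator function of the simplices with `k ≤ 1` vertices. -/
def countLength (k : ℕ) (hk : k ≤ 1) : Chains K →ₗ[ℤ] ℤ :=
  chainFunctional (fun l => if l.length = k then 1 else 0)
    -- A sequence with two adjacent marked entries has length at least 2 > k, so the alternating
    -- conditions are vacuous. For larger k the indicator would not be alternating.
    (fun l m a b => by rw [if_neg (by simp; omega), if_neg (by simp; omega), add_zero])
    (fun l m a => by rw [if_neg (by simp; omega)])
    (fun l hl => by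
      rw [if_neg]
      rintro rfl
      exact hl (isFace_of_length_le_one hk))

theorem countLength_simplex (k : ℕ) (hk : k ≤ 1) (l : List V) :
    countLength K k hk (simplex K l) = if l.length = k then 1 else 0 :=
  chainFunctional_simplex _ _ _ _ l

variable (K) in
/-- The join with a chosen vertex of `t`. -/
def cone (t : Finset V) : Chains K →ₗ[ℤ] Chains K :=
  if h : t.Nonempty then consVertex K h.choose else 0

theorem cone_empty : cone K ∅ = 0 :=
  dif_neg (by simp)

theorem exists_cone_eq {t : Finset V} (h : t.Nonempty) : ∃ v ∈ t, cone K t = consVertex K v :=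
  ⟨h.choose, h.choose_spec, dif_pos h⟩

theorem bd_nil : bd K [] = 0 := by
  simp [bd, boundaryList]

/-- The cone formula d(v·σ) = σ - v·dσ, with v ∈ t so that v·σ stays inside the face t. The
correction term occurs when σ has exactly a vertices: the truncated boundary is then zero on σ,
while the untruncated `bd` still appears in d(v·σ). -/
theorem boundary_cone {a : ℕ} {s : List V} {t : Finset V} (ht : IsFace K t) (hne : t.Nonempty)
    (hst : s.toFinset ⊆ t) (has : a ≤ s.length) :
    boundary K a (cone K t (simplex K s)) + cone K t (boundary K a (simplex K s)) =
      simplex K s - if a < s.length then 0 else cone K t (bd K s) := by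
  obtain ⟨v, hv, hcone⟩ := exists_cone_eq (K := K) hne
  have hvs : IsFace K (v :: s).toFinset := isFace_mono ht (by
    rw [List.toFinset_cons]
    exact Finset.insert_subset hv hst)
  have hs : IsFace K s.toFinset := isFace_mono ht hst
  rw [hcone, consVertex_simplex, boundary_mk_single, if_pos ⟨hvs, by simpa using by omega⟩,
    boundary_mk_single]
  by_cases h : a < s.length
  · rw [if_pos ⟨hs, h⟩, if_pos h]
    change bd K (v :: s) + consVertex K v (bd K s) = _
    rw [bd_cons]
    abel
  · rw [if_neg (fun h' => h h'.2), if_neg h]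
    change bd K (v :: s) + _ = _
    rw [bd_cons, map_zero, add_zero]

variable (K) in
/-- The contraction of the columns of the double complex. -/
def columnCone : (Chains K ⊗[ℤ] Chains K) →ₗ[ℤ] (Chains K ⊗[ℤ] Chains K) :=
  -- The apex depends on the second factor τ, but only through its vertex set, so the construction
  -- descends to chains in the second variable first; the flips restore the order.
  TensorProduct.lift (supportLift (K := K) fun t =>
    ((TensorProduct.mk ℤ (Chains K) (Chains K)) ∘ₗ cone K t).flip).flip

theorem columnCone_tmul (x : Chains K) (t : List V) :
    columnCone K (x ⊗ₜ[ℤ] simplex K t) = cone K t.toFinset x ⊗ₜ[ℤ] simplex K t := by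
  rw [columnCone, TensorProduct.lift.tmul, LinearMap.flip_apply, supportLift_simplex]
  rfl

variable (K) in
/-- The chains of the double complex whose second factor has at least `q` vertices. -/
def upperGroup (a q : ℕ) : Submodule ℤ (Chains K ⊗[ℤ] Chains K) :=
  Submodule.span ℤ {x | ∃ s t : List V, a ≤ s.length ∧ s ⊆ t ∧ q ≤ t.length ∧
    x = simplex K s ⊗ₜ[ℤ] simplex K t}

theorem totalGroup_le_upperGroup (a : ℕ) (n : ℤ) : totalGroup K a n ≤ upperGroup K a 0 := by
  refine iSup_le fun p => Submodule.span_mono ?_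
  rintro _ ⟨s, t, ha, _, _, hst, rfl⟩
  exact ⟨s, t, ha, hst, Nat.zero_le _, rfl⟩

theorem tmul_mem_totalGroup {a : ℕ} {n : ℤ} {s t : List V} (ha : a ≤ s.length) (hst : s ⊆ t)
    (hn : (t.length : ℤ) - s.length = n) :
    simplex K s ⊗ₜ[ℤ] simplex K t ∈ totalGroup K a n :=
  Submodule.mem_iSup_of_mem ((s.length : ℤ) - 1)
    (Submodule.subset_span ⟨s, t, ha, by ring, by omega, hst, rfl⟩)

theorem totalGroup_le {a : ℕ} {n : ℤ} {P : Submodule ℤ (Chains K ⊗[ℤ] Chains K)}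
    (h : ∀ s t : List V, a ≤ s.length → s ⊆ t → (t.length : ℤ) - s.length = n →
      simplex K s ⊗ₜ[ℤ] simplex K t ∈ P) : totalGroup K a n ≤ P := by
  refine iSup_le fun p => Submodule.span_le.2 ?_
  rintro _ ⟨s, t, ha, hs, ht, hst, rfl⟩
  exact h s t ha hst (by omega)

theorem upperGroup_le {a q : ℕ} {P : Submodule ℤ (Chains K ⊗[ℤ] Chains K)}
    (h : ∀ s t : List V, a ≤ s.length → s ⊆ t → q ≤ t.length →
      simplex K s ⊗ₜ[ℤ] simplex K t ∈ P) : upperGroup K a q ≤ P := by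
  refine Submodule.span_le.2 ?_
  rintro _ ⟨s, t, ha, hst, hq, rfl⟩
  exact h s t ha hst hq

theorem eqOn_upperGroup {a q : ℕ} {M : Type*} [AddCommGroup M]
    {f g : (Chains K ⊗[ℤ] Chains K) →ₗ[ℤ] M}
    (h : ∀ s t : List V, a ≤ s.length → s ⊆ t → q ≤ t.length →
      f (simplex K s ⊗ₜ[ℤ] simplex K t) = g (simplex K s ⊗ₜ[ℤ] simplex K t)) :
    ∀ x ∈ upperGroup K a q, f x = g x :=
  fun _ hx => upperGroup_le (P := LinearMap.eqLocus f g) h hx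

theorem simplex_eq_zero_of_card_lt [Fintype V] {l : List V} (h : Fintype.card V < l.length) :
    simplex K l = 0 :=
  simplex_eq_zero (Or.inl fun hl => absurd hl.length_le_card (not_le.2 h))

/-- The filtration by the length of τ is finite, since a sequence longer than |V| repeats a vertex.
This is the source of nilpotency. -/
theorem upperGroup_eq_bot [Fintype V] {a q : ℕ} (hq : Fintype.card V < q) :
    upperGroup K a q = ⊥ := by
  refine le_bot_iff.1 (upperGroup_le fun s t _ _ ht => ?_)
  rw [simplex_eq_zero_of_card_lt (hq.trans_le ht), TensorProduct.tmul_zero]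
  exact Submodule.zero_mem _

/-- The cone fixes the second factor and either vanishes or adds one vertex to the first. Hence it
lowers the total degree by one and preserves the filtration by the length of τ. -/
theorem cone_tmul_mem_span {s t : List V} (hst : s ⊆ t) :
    ∃ x : Chains K, columnCone K (simplex K s ⊗ₜ[ℤ] simplex K t) = x ⊗ₜ[ℤ] simplex K t ∧
      (x = 0 ∨ ∃ v : V, v :: s ⊆ t ∧ x = simplex K (v :: s)) := by
  refine ⟨_, columnCone_tmul _ _, ?_⟩
  rcases t.toFinset.eq_empty_or_nonempty with h | h
  · left
    rw [h, cone_empty, LinearMap.zero_apply]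
  · right
    obtain ⟨v, hv, hc⟩ := exists_cone_eq (K := K) h
    exact ⟨v, List.cons_subset.2 ⟨List.mem_toFinset.1 hv, hst⟩, by rw [hc, consVertex_simplex]⟩

theorem columnCone_mem_upperGroup {a q : ℕ} {x : Chains K ⊗[ℤ] Chains K}
    (hx : x ∈ upperGroup K a q) : columnCone K x ∈ upperGroup K a q := by
  refine upperGroup_le (P := (upperGroup K a q).comap (columnCone K)) (fun s t ha hst hq => ?_) hx
  obtain ⟨x, hx, rfl | ⟨v, hv, rfl⟩⟩ := cone_tmul_mem_span (K := K) hst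
  · rw [Submodule.mem_comap, hx, TensorProduct.zero_tmul]
    exact Submodule.zero_mem _
  · rw [Submodule.mem_comap, hx]
    exact Submodule.subset_span ⟨_, _, by simpa using by omega, hv, hq, rfl⟩

theorem columnCone_mem_totalGroup {a : ℕ} {m n : ℤ} (hmn : n + 1 = m)
    {x : Chains K ⊗[ℤ] Chains K}
    (hx : x ∈ totalGroup K a m) : columnCone K x ∈ totalGroup K a n := by
  refine totalGroup_le (P := (totalGroup K a n).comap (columnCone K)) (fun s t ha hst hn => ?_) hx
  obtain ⟨x, hx, rfl | ⟨v, hv, rfl⟩⟩ := cone_tmul_mem_span (K := K) hst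
  · rw [Submodule.mem_comap, hx, TensorProduct.zero_tmul]
    exact Submodule.zero_mem _
  · rw [Submodule.mem_comap, hx]
    exact tmul_mem_totalGroup (by simpa using by omega) hv (by simp; omega)

variable [Fintype V]

theorem rowDiff_mem_upperGroup {a q : ℕ} {x : Chains K ⊗[ℤ] Chains K}
    (hx : x ∈ upperGroup K a q) :
    TensorProduct.map (signOp K) (coboundary K) x ∈ upperGroup K a (q + 1) := by
  refine upperGroup_le (P := (upperGroup K a (q + 1)).comap
    (TensorProduct.map (signOp K) (coboundary K))) (fun s t ha hst hq => ?_) hx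
  rw [Submodule.mem_comap, TensorProduct.map_tmul, signOp_simplex, coboundary_simplex,
    TensorProduct.tmul_sum]
  refine Submodule.sum_mem _ fun v _ => ?_
  rw [← TensorProduct.smul_tmul']
  refine Submodule.smul_mem _ _ (Submodule.subset_span ?_)
  exact ⟨s, v :: t, ha, fun y hy => List.mem_cons_of_mem _ (hst hy), by simpa using hq, rfl⟩

/-- The total complex is homotopy equivalent to any complex that computes the homology of
its columns. -/
theorem nonempty_totalComplex_homotopyEquiv (a : ℕ) {B : Type u} [AddCommGroup B]
    {D' : B →ₗ[ℤ] B} {G' : ℤ → Submodule ℤ B}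
    (hG' : ∀ i j, (ComplexShape.up ℤ).Rel i j → ∀ x ∈ G' i, D' x ∈ G' j) (hD' : D' ∘ₗ D' = 0)
    (ε : (Chains K ⊗[ℤ] Chains K) →ₗ[ℤ] B) (σ : B →ₗ[ℤ] (Chains K ⊗[ℤ] Chains K))
    (hcol : ∀ s t : List V, a ≤ s.length → s ⊆ t →
      TensorProduct.map (boundary K a) LinearMap.id (columnCone K
        (simplex K s ⊗ₜ[ℤ] simplex K t)) +
      columnCone K (TensorProduct.map (boundary K a) LinearMap.id
        (simplex K s ⊗ₜ[ℤ] simplex K t)) =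
      simplex K s ⊗ₜ[ℤ] simplex K t - σ (ε (simplex K s ⊗ₜ[ℤ] simplex K t)))
    (hεD : ∀ s t : List V, a ≤ s.length → s ⊆ t →
      D' (ε (simplex K s ⊗ₜ[ℤ] simplex K t)) =
        ε (doubleDiff K a (simplex K s ⊗ₜ[ℤ] simplex K t)))
    (hεh : ∀ s t : List V, a ≤ s.length → s ⊆ t →
      ε (columnCone K (simplex K s ⊗ₜ[ℤ] simplex K t)) = 0)
    (hε : ∀ s t : List V, a ≤ s.length → s ⊆ t →
      ε (simplex K s ⊗ₜ[ℤ] simplex K t) ∈ G' (t.length - s.length))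
    (hσ : ∀ n, ∀ x ∈ G' n, σ x ∈ totalGroup K a n) (hεσ : ∀ n, ∀ x ∈ G' n, ε (σ x) = x) :
    Nonempty (HomotopyEquiv (totalComplex K a)
      (complexOfEnd (ComplexShape.up ℤ) D' G' hG' hD')) := by
  -- The identities assumed on generators σ ⊗ τ extend linearly to their span.
  have hcol' := eqOn_upperGroup (a := a) (q := 0)
    (f := TensorProduct.map (boundary K a) LinearMap.id ∘ₗ columnCone K +
      columnCone K ∘ₗ TensorProduct.map (boundary K a) LinearMap.id)
    (g := LinearMap.id - σ ∘ₗ ε) fun s t ha hst _ => hcol s t ha hst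
  have hεD' := eqOn_upperGroup (a := a) (q := 0) (f := D' ∘ₗ ε) (g := ε ∘ₗ doubleDiff K a)
    fun s t ha hst _ => hεD s t ha hst
  have hεh' := eqOn_upperGroup (a := a) (q := 0) (f := ε ∘ₗ columnCone K) (g := 0)
    fun s t ha hst _ => hεh s t ha hst
  have hmono : ∀ q, upperGroup K a q ≤ upperGroup K a 0 := fun q =>
    upperGroup_le fun s t ha hst _ => Submodule.subset_span ⟨s, t, ha, hst, Nat.zero_le _, rfl⟩
  set θ : Module.End ℤ (Chains K ⊗[ℤ] Chains K) :=
    1 - doubleDiff K a * columnCone K - columnCone K * doubleDiff K a with hθ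
  -- On ker ε the column differential satisfies dh + hd = 1, which cancels the identity in θ and
  -- leaves only the row differential.
  have hθ' : ∀ q, ∀ x ∈ upperGroup K a q, ε x = 0 → θ x =
      -(TensorProduct.map (signOp K) (coboundary K) (columnCone K x) +
        columnCone K (TensorProduct.map (signOp K) (coboundary K) x)) := by
    intro q x hx h0
    have h1 := hcol' x (hmono q hx)
    change _ + _ = x - σ (ε x) at h1
    rw [h0, map_zero, sub_zero, LinearMap.comp_apply, LinearMap.comp_apply] at h1
    simp only [hθ, LinearMap.sub_apply, Module.End.one_apply, Module.End.mul_apply, doubleDiff,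
      LinearMap.add_apply, map_add]
    nth_rw 1 [← h1]
    abel
  have hDx : ∀ x ∈ upperGroup K a 0, doubleDiff K a x ∈ upperGroup K a 0 := by
    refine fun x hx => upperGroup_le (P := (upperGroup K a 0).comap (doubleDiff K a))
      (fun s t ha hst _ => totalGroup_le_upperGroup a _ (doubleDiff_mem rfl
        (tmul_mem_totalGroup ha hst rfl))) hx
  -- The row differential adds a vertex to τ and the cone does not change τ. Since ker ε is
  -- preserved as well, the step can be iterated.
  have hstep : ∀ q, ∀ x ∈ upperGroup K a q, ε x = 0 →
      θ x ∈ upperGroup K a (q + 1) ∧ ε (θ x) = 0 := by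
    intro q x hx h0
    constructor
    · rw [hθ' q x hx h0]
      exact Submodule.neg_mem _ (Submodule.add_mem _
        (rowDiff_mem_upperGroup (columnCone_mem_upperGroup hx))
        (columnCone_mem_upperGroup (rowDiff_mem_upperGroup hx)))
    · have hx0 := hmono q hx
      have h1 := hεD' _ (columnCone_mem_upperGroup hx0)
      have h2 := hεh' x hx0
      have h3 := hεh' _ (hDx x hx0)
      simp only [LinearMap.comp_apply, LinearMap.zero_apply] at h1 h2 h3
      simp only [hθ, LinearMap.sub_apply, Module.End.one_apply, Module.End.mul_apply, map_sub]
      rw [← h1, h2, h3, h0, map_zero, sub_zero, sub_zero]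
  have hpow : ∀ k : ℕ, ∀ x ∈ upperGroup K a 0, ε x = 0 →
      (θ ^ k) x ∈ upperGroup K a k ∧ ε ((θ ^ k) x) = 0 := by
    intro k x hx h0
    induction k with
    | zero => exact ⟨hx, h0⟩
    | succ k ih =>
      rw [pow_succ', Module.End.mul_apply]
      exact hstep k _ ih.1 ih.2
  refine nonempty_homotopyEquiv (G := totalGroup K a) (doubleDiff_comp_doubleDiff a) hD'
    (fun _ _ h _ hx => doubleDiff_mem h hx) hG' ε σ (columnCone K) ?_ ?_ hσ hεσ ?_ ?_
    -- After |V| + 1 steps τ would have more than |V| entries.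
    (Fintype.card V + 1) ?_
  · exact fun n x hx => totalGroup_le (P := (G' n).comap ε)
      (fun s t ha hst hn => by
        rw [Submodule.mem_comap, ← hn]; exact hε s t ha hst) hx
  · exact fun n x hx => hεD' x (totalGroup_le_upperGroup a n hx)
  · exact fun i j hij x hx => columnCone_mem_totalGroup hij hx
  · exact fun n x hx => hεh' x (totalGroup_le_upperGroup a n hx)
  · intro n x hx h0
    have h := (hpow (Fintype.card V + 1) x (totalGroup_le_upperGroup a n hx) h0).1
    rwa [upperGroup_eq_bot (Nat.lt_succ_self _), Submodule.mem_bot] at h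

end Columns

/-! ### The homology of the columns, unreduced and reduced. -/

section Augmentation

variable {V : Type u} [DecidableEq V] {K : AbstractSimplicialComplex V}

theorem subset_toFinset {s t : List V} (h : s ⊆ t) : s.toFinset ⊆ t.toFinset := fun x hx => by
  rw [List.mem_toFinset] at hx ⊢
  exact h hx

theorem cone_simplex_nil {t : List V} (h : t ≠ []) :
    ∃ v ∈ t, cone K t.toFinset (simplex K []) = simplex K [v] := by
  obtain ⟨v, hv, hc⟩ := exists_cone_eq (K := K) (List.toFinset_nonempty_iff t |>.2 h)
  exact ⟨v, List.mem_toFinset.1 hv, by rw [hc, consVertex_simplex]⟩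

/-- If t is not a face everything is zero; otherwise this is `boundary_cone` tensored with the fixed
second factor. An apex requires t to be nonempty. -/
theorem column_homotopy {a : ℕ} {s t : List V} (ha : a ≤ s.length) (hst : s ⊆ t) (hne : t ≠ []) :
    TensorProduct.map (boundary K a) LinearMap.id (columnCone K
      (simplex K s ⊗ₜ[ℤ] simplex K t)) +
    columnCone K (TensorProduct.map (boundary K a) LinearMap.id
      (simplex K s ⊗ₜ[ℤ] simplex K t)) =
    simplex K s ⊗ₜ[ℤ] simplex K t - (if a < s.length then 0 else cone K t.toFinset (bd K s)) ⊗ₜ[ℤ]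
      simplex K t := by
  by_cases ht : IsFace K t.toFinset
  · rw [columnCone_tmul, TensorProduct.map_tmul, TensorProduct.map_tmul, LinearMap.id_apply,
      columnCone_tmul, ← TensorProduct.add_tmul, boundary_cone ht
      (List.toFinset_nonempty_iff t |>.2 hne) (subset_toFinset hst) ha, TensorProduct.sub_tmul]
  · simp only [simplex_eq_zero (Or.inr ht), TensorProduct.tmul_zero, map_zero, sub_self, add_zero]

theorem doubleDiff_tmul [Fintype V] (a : ℕ) (s t : List V) :
    doubleDiff K a (simplex K s ⊗ₜ[ℤ] simplex K t) =
      boundary K a (simplex K s) ⊗ₜ[ℤ] simplex K t +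
        ((-1 : ℤ) ^ s.length • simplex K s) ⊗ₜ[ℤ] coboundary K (simplex K t) := by
  rw [doubleDiff, LinearMap.add_apply, TensorProduct.map_tmul, TensorProduct.map_tmul,
    signOp_simplex, LinearMap.id_apply]

theorem signOp_coboundary_simplex [Fintype V] (t : List V) :
    signOp K (coboundary K (simplex K t)) =
      -((-1 : ℤ) ^ t.length • coboundary K (simplex K t)) := by
  simp only [coboundary_simplex, map_sum, signOp_simplex, List.length_cons, pow_succ, mul_neg_one,
    neg_smul, Finset.sum_neg_distrib, Finset.smul_sum]

/-- Only edges can have vertices in their boundary, and d(v,w) = (w) - (v) has total coefficient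
zero. -/
theorem countLength_one_boundary (s : List V) :
    countLength K 1 le_rfl (boundary K 1 (simplex K s)) = 0 := by
  by_cases h : 1 < s.length
  · by_cases hs : IsFace K s.toFinset
    · rw [boundary_simplex 1 s hs h, map_sum]
      by_cases h2 : s.length = 2
      · obtain ⟨v, w, rfl⟩ := List.length_eq_two.1 h2
        simp [Finset.sum_range_succ, countLength_simplex]
      · refine Finset.sum_eq_zero fun i hi => ?_
        have hlen := List.length_eraseIdx_of_lt (Finset.mem_range.1 hi)
        rw [map_smul, countLength_simplex, if_neg (by omega), smul_zero]
    · rw [simplex_eq_zero (Or.inr hs), map_zero, map_zero]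
  · rw [boundary_simplex_of_le 1 s (not_lt.1 h), map_zero]

variable (K) in
/-- The augmentation of the columns of the double complex: `v ⊗ τ ↦ (-1)^{|τ|} τ`. -/
def augmentation : (Chains K ⊗[ℤ] Chains K) →ₗ[ℤ] Chains K :=
  (TensorProduct.lid ℤ (Chains K)).toLinearMap ∘ₗ
    TensorProduct.map (countLength K 1 le_rfl) (signOp K)

theorem augmentation_tmul (x y : Chains K) :
    augmentation K (x ⊗ₜ[ℤ] y) = countLength K 1 le_rfl x • signOp K y := by
  rw [augmentation, LinearMap.comp_apply, TensorProduct.map_tmul]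
  exact TensorProduct.lid_tmul _ _

variable (K) in
/-- The section `τ ↦ (-1)^{|τ|} b(τ) ⊗ τ` of the augmentation, with `b(τ)` the chosen vertex. -/
def augmentationSection : Chains K →ₗ[ℤ] (Chains K ⊗[ℤ] Chains K) :=
  columnCone K ∘ₗ TensorProduct.mk ℤ (Chains K) (Chains K) (simplex K []) ∘ₗ signOp K

theorem augmentationSection_simplex (t : List V) :
    augmentationSection K (simplex K t) =
      cone K t.toFinset (simplex K []) ⊗ₜ[ℤ] ((-1 : ℤ) ^ t.length • simplex K t) := by
  rw [augmentationSection, LinearMap.comp_apply, LinearMap.comp_apply, signOp_simplex,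
    TensorProduct.mk_apply, TensorProduct.tmul_smul, map_smul, columnCone_tmul,
    TensorProduct.tmul_smul]

theorem chainGroup_le {a : ℕ} {n : ℤ} {P : Submodule ℤ (Chains K)}
    (h : ∀ l : List V, a ≤ l.length → (l.length : ℤ) = n + 1 → simplex K l ∈ P) :
    chainGroup K a n ≤ P := by
  refine Submodule.span_le.2 ?_
  rintro _ ⟨l, ha, hl, rfl⟩
  exact h l ha hl

theorem simplex_mem_chainGroup {a : ℕ} {n : ℤ} {l : List V} (ha : a ≤ l.length)
    (hl : (l.length : ℤ) = n + 1) : simplex K l ∈ chainGroup K a n :=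
  Submodule.subset_span ⟨l, ha, hl, rfl⟩

theorem ne_nil_of_subset {s t : List V} (ha : 1 ≤ s.length) (hst : s ⊆ t) : t ≠ [] := by
  rintro rfl
  rw [List.subset_nil.1 hst] at ha
  exact absurd ha (by simp)

theorem neg_one_pow_mul_self (n : ℕ) : (-1 : ℤ) ^ n * (-1) ^ n = 1 := by
  rw [← mul_pow]; simp

/-- With σ nonempty, each τ is nonempty and its column has homology ℤ in p = 0. The sign (-1)^{|τ|}
in the augmentation absorbs the factor -1 in Δ(v ⊗ τ) = -v ⊗ δτ, because δ raises |τ| by one. -/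
theorem nonempty_homotopyEquiv_cochainComplex [Fintype V] :
    Nonempty (HomotopyEquiv (totalComplex K 1) (cochainComplex K)) := by
  refine nonempty_totalComplex_homotopyEquiv 1 (fun _ _ h _ hx => coboundary_mem h hx)
    coboundary_comp_coboundary (augmentation K) (augmentationSection K) ?_ ?_ ?_ ?_ ?_ ?_
  · intro s t ha hst
    rw [column_homotopy ha hst (ne_nil_of_subset ha hst), augmentation_tmul, countLength_simplex,
      signOp_simplex]
    congr 1
    -- For a vertex, `bd` gives (∅), so the correction in `column_homotopy` is b(τ) ⊗ τ; this is the
    -- section applied to the augmentation, where the sign occurs twice and cancels. Longer σ have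
    -- no correction.
    by_cases h : s.length = 1
    · rw [if_neg (by omega), if_pos h, one_smul, map_smul, augmentationSection_simplex,
        ← TensorProduct.tmul_smul, smul_smul, neg_one_pow_mul_self, one_smul]
      obtain ⟨v, rfl⟩ := List.length_eq_one_iff.1 h
      rw [bd_cons, bd_nil, map_zero, sub_zero]
    · rw [if_pos (by omega), if_neg h, zero_smul, map_zero, TensorProduct.zero_tmul]
  · intro s t ha hst
    rw [doubleDiff_tmul, map_add, augmentation_tmul, augmentation_tmul, augmentation_tmul,
      countLength_one_boundary, zero_smul, zero_add, map_smul, countLength_simplex, signOp_simplex,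
      signOp_coboundary_simplex]
    by_cases h : s.length = 1
    · simp [h, countLength_simplex]
    · simp [h, countLength_simplex]
  · intro s t ha hst
    obtain ⟨x, hx, rfl | ⟨v, _, rfl⟩⟩ := cone_tmul_mem_span (K := K) hst
    · rw [hx, TensorProduct.zero_tmul, map_zero]
    · rw [hx, augmentation_tmul, countLength_simplex,
        if_neg (by rw [List.length_cons]; omega), zero_smul]
  · intro s t ha hst
    rw [augmentation_tmul, countLength_simplex, signOp_simplex]
    split_ifs with h
    · rw [one_smul]
      have := List.length_pos_iff.2 (ne_nil_of_subset ha hst)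
      exact Submodule.smul_mem _ _ (simplex_mem_chainGroup this (by rw [h]; simp))
    · rw [zero_smul]
      exact Submodule.zero_mem _
  · refine fun n => chainGroup_le (P := (totalGroup K 1 n).comap (augmentationSection K))
      fun l hl hn => ?_
    rw [Submodule.mem_comap, augmentationSection_simplex, TensorProduct.tmul_smul]
    obtain ⟨v, hv, hc⟩ := cone_simplex_nil (K := K) (List.length_pos_iff.1 hl)
    rw [hc]
    exact Submodule.smul_mem _ _ (tmul_mem_totalGroup le_rfl (by simpa using hv) (by simp; omega))
  · refine fun n => chainGroup_le (P := LinearMap.eqLocus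
      (augmentation K ∘ₗ augmentationSection K) LinearMap.id) fun l hl hn => ?_
    rw [LinearMap.mem_eqLocus, LinearMap.comp_apply, augmentationSection_simplex,
      augmentation_tmul, LinearMap.id_apply]
    obtain ⟨v, hv, hc⟩ := cone_simplex_nil (K := K) (List.length_pos_iff.1 hl)
    rw [hc, countLength_simplex, if_pos (by simp), one_smul, map_smul, signOp_simplex, smul_smul,
      neg_one_pow_mul_self, one_smul]

/-- The complex with the integers in degree `0`. -/
def integerComplex : CochainComplex (ModuleCat.{u} ℤ) ℤ :=
  complexOfEnd (A := ULift.{u} ℤ) (ComplexShape.up ℤ) 0 (fun n => if n = 0 then ⊤ else ⊥)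
    (fun _ _ _ _ _ => Submodule.zero_mem _) (LinearMap.zero_comp _)

variable (K) in
/-- The coefficient of `∅ ⊗ ∅`. -/
def emptyCoefficient : (Chains K ⊗[ℤ] Chains K) →ₗ[ℤ] ULift.{u} ℤ :=
  (ULift.moduleEquiv : ULift.{u} ℤ ≃ₗ[ℤ] ℤ).symm.toLinearMap ∘ₗ
    (TensorProduct.lid ℤ ℤ).toLinearMap ∘ₗ
      TensorProduct.map (countLength K 0 zero_le_one) (countLength K 0 zero_le_one)

theorem emptyCoefficient_tmul (x y : Chains K) :
    emptyCoefficient K (x ⊗ₜ[ℤ] y) =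
      ULift.up (countLength K 0 zero_le_one x * countLength K 0 zero_le_one y) := by
  rw [emptyCoefficient, LinearMap.comp_apply, LinearMap.comp_apply, TensorProduct.map_tmul]
  exact congrArg _ (TensorProduct.lid_tmul _ _)

theorem emptyCoefficient_of_ne_nil (x : Chains K) {t : List V} (ht : t ≠ []) :
    emptyCoefficient K (x ⊗ₜ[ℤ] simplex K t) = 0 := by
  rw [emptyCoefficient_tmul, countLength_simplex,
    if_neg (fun h => ht (List.length_eq_zero_iff.1 h)), mul_zero]
  rfl

/-- Columns with τ ≠ ∅ are augmented complexes of full simplices and so contractible. The column of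
∅ consists of ∅ ⊗ ∅, where the cone is zero by convention and the projection to the surviving part
is the identity. -/
theorem nonempty_homotopyEquiv_integerComplex [Fintype V] :
    Nonempty (HomotopyEquiv (totalComplex K 0) integerComplex) := by
  let σ : ULift.{u} ℤ →ₗ[ℤ] (Chains K ⊗[ℤ] Chains K) :=
    LinearMap.toSpanSingleton ℤ _ (simplex K [] ⊗ₜ[ℤ] simplex K []) ∘ₗ
      (ULift.moduleEquiv : ULift.{u} ℤ ≃ₗ[ℤ] ℤ).toLinearMap
  have hσ : ∀ r : ULift.{u} ℤ, σ r = r.down • (simplex K [] ⊗ₜ[ℤ] simplex K []) := fun r => rfl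
  have h0 : emptyCoefficient K (simplex K [] ⊗ₜ[ℤ] simplex K []) = ULift.up 1 := by
    rw [emptyCoefficient_tmul, countLength_simplex]
    rfl
  refine nonempty_totalComplex_homotopyEquiv 0 _ _ (emptyCoefficient K) σ ?_ ?_ ?_ ?_ ?_ ?_
  · intro s t ha hst
    by_cases ht : t = []
    · subst ht
      obtain rfl := List.subset_nil.1 hst
      rw [columnCone_tmul, TensorProduct.map_tmul, TensorProduct.map_tmul,
        boundary_simplex_of_le 0 [] le_rfl, h0, hσ,
        List.toFinset_nil, cone_empty]
      simp
    · rw [column_homotopy ha hst ht, emptyCoefficient_of_ne_nil _ ht, map_zero]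
      congr 1
      split_ifs with h
      · rw [TensorProduct.zero_tmul]
      · obtain rfl := List.length_eq_zero_iff.1 (Nat.eq_zero_of_not_pos h)
        rw [bd_nil, map_zero, TensorProduct.zero_tmul]
  · intro s t ha hst
    rw [LinearMap.zero_apply, doubleDiff_tmul, map_add, coboundary_simplex, TensorProduct.tmul_sum,
      map_sum, Finset.sum_eq_zero fun v _ => emptyCoefficient_of_ne_nil _ (List.cons_ne_nil v t),
      add_zero]
    by_cases ht : t = []
    · subst ht
      obtain rfl := List.subset_nil.1 hst
      rw [boundary_simplex_of_le 0 [] le_rfl, TensorProduct.zero_tmul, map_zero]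
    · rw [emptyCoefficient_of_ne_nil _ ht]
  · intro s t ha hst
    rw [columnCone_tmul]
    by_cases ht : t = []
    · subst ht
      rw [List.toFinset_nil, cone_empty, LinearMap.zero_apply, TensorProduct.zero_tmul, map_zero]
    · rw [emptyCoefficient_of_ne_nil _ ht]
  · intro s t ha hst
    by_cases ht : t = []
    · subst ht
      obtain rfl := List.subset_nil.1 hst
      rw [if_pos (by simp)]
      trivial
    · rw [emptyCoefficient_of_ne_nil _ ht]
      exact Submodule.zero_mem _
  · intro n x hx
    by_cases hn : n = 0
    · rw [hσ]
      exact Submodule.smul_mem _ _ (tmul_mem_totalGroup le_rfl (List.Subset.refl _) (by simp [hn]))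
    · rw [if_neg hn] at hx
      rw [(Submodule.mem_bot ℤ).1 hx, map_zero]
      exact Submodule.zero_mem _
  · intro n x _
    rw [hσ, map_smul, h0]
    exact ULift.ext _ _ (mul_one _)

theorem integerComplex_d (i j : ℤ) : integerComplex.{u}.d i j = 0 := by
  by_cases h : (ComplexShape.up ℤ).Rel i j
  · rw [integerComplex, complexOfEnd_d _ _ h]
    rfl
  · exact integerComplex.shape i j h

theorem dualComplex_integerComplex_d (i j : ℤ) : (dualComplex integerComplex.{u}).d i j = 0 := by
  have h : (dualComplex integerComplex.{u}).d i j = dualHom (integerComplex.d j i) := rfl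
  rw [h, integerComplex_d]
  refine ModuleCat.hom_ext (LinearMap.ext fun (φ : integerComplex.{u}.X i →ₗ[ℤ] ℤ) =>
    LinearMap.ext fun x => map_zero φ)

theorem nonempty_integerComplex_zero_equiv :
    Nonempty (integerComplex.{u}.X 0 ≃ₗ[ℤ] ℤ) :=
  ⟨(LinearEquiv.ofTop (⊤ : Submodule ℤ (ULift.{u} ℤ)) rfl).trans ULift.moduleEquiv⟩

theorem subsingleton_integerComplex {n : ℤ} (hn : n ≠ 0) :
    Subsingleton (integerComplex.{u}.X n) := by
  change Subsingleton ((if n = 0 then ⊤ else ⊥ : Submodule ℤ (ULift.{u} ℤ)))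
  rw [if_neg hn]
  infer_instance

theorem subsingleton_dualComplex_integerComplex {n : ℤ} (hn : n ≠ 0) :
    Subsingleton ((dualComplex integerComplex.{u}).X n) := by
  have := subsingleton_integerComplex.{u} hn
  change Subsingleton (integerComplex.{u}.X n →ₗ[ℤ] ℤ)
  infer_instance

end Augmentation

/-! ### Duality between chains and cochains. -/

section Duality

variable {V : Type u} [DecidableEq V] (e : V → ℤ)

/-- The orientation sign of a vertex followed by a set of vertices. -/
def joinSign (v : V) (t : Finset V) : ℤ :=
  ∏ w ∈ t, Int.sign (e w - e v)

/-- The sign of the permutation that sorts a sequence of vertices, and `0` if an entry is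
repeated. -/
def listSign : List V → ℤ
  | [] => 1
  | v :: l => (l.map fun w => Int.sign (e w - e v)).prod * listSign l

theorem listSign_cons_of_mem {v : V} {l : List V} (h : v ∈ l) : listSign e (v :: l) = 0 := by
  rw [listSign, List.prod_eq_zero, zero_mul]
  exact List.mem_map.2 ⟨v, h, by simp⟩

theorem listSign_of_not_nodup {l : List V} (h : ¬ l.Nodup) : listSign e l = 0 := by
  induction l with
  | nil => simp at h
  | cons v l ih =>
    by_cases hv : v ∈ l
    · exact listSign_cons_of_mem e hv
    · rw [listSign, ih fun hl => h (List.nodup_cons.2 ⟨hv, hl⟩), mul_zero]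

/-- The factor contributed by v depends only on the vertex set of l. If l repeats an entry, the
products over l and over its vertex set may differ, but `listSign e l` vanishes. -/
theorem listSign_cons (v : V) (l : List V) :
    listSign e (v :: l) = joinSign e v l.toFinset * listSign e l := by
  by_cases h : l.Nodup
  · rw [listSign, joinSign, List.prod_toFinset _ h]
  · rw [listSign, listSign_of_not_nodup e h, mul_zero, mul_zero]

theorem listSign_swap (l m : List V) (a b : V) :
    listSign e (l ++ a :: b :: m) + listSign e (l ++ b :: a :: m) = 0 := by
  induction l with
  | nil =>
    have h : Int.sign (e b - e a) = -Int.sign (e a - e b) := by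
      rw [← Int.sign_neg, neg_sub]
    simp only [List.nil_append, listSign, List.map_cons, List.prod_cons, h]
    ring
  | cons v l ih =>
    have h : ((l ++ a :: b :: m).map fun w => Int.sign (e w - e v)).prod =
        ((l ++ b :: a :: m).map fun w => Int.sign (e w - e v)).prod := by
      simp only [List.map_append, List.map_cons, List.prod_append, List.prod_cons]
      ring
    rw [List.cons_append, List.cons_append, listSign, listSign, h, ← mul_add, ih, mul_zero]

theorem joinSign_of_mem {v : V} {t : Finset V} (h : v ∈ t) : joinSign e v t = 0 :=
  Finset.prod_eq_zero h (by simp)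

/-- The coefficient of a sequence at a set of vertices. -/
def listCoeff (t : Finset V) (l : List V) : ℤ :=
  if l.toFinset = t then listSign e l else 0

theorem listCoeff_cons (t : Finset V) (v : V) (l : List V) :
    listCoeff e t (v :: l) =
      if v ∈ t then joinSign e v (t.erase v) * listCoeff e (t.erase v) l else 0 := by
  by_cases hv : v ∈ t
  · rw [if_pos hv]
    by_cases hl : v ∈ l
    · have h : l.toFinset ≠ t.erase v := fun h => by
        have := List.mem_toFinset.2 hl
        rw [h] at this
        exact Finset.notMem_erase v t this
      rw [listCoeff, listSign_cons_of_mem e hl, ite_self, listCoeff, if_neg h, mul_zero]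
    · have h : (v :: l).toFinset = t ↔ l.toFinset = t.erase v := by
        rw [List.toFinset_cons]
        constructor
        · rintro rfl
          rw [Finset.erase_insert (by simpa using hl)]
        · intro h
          rw [h, Finset.insert_erase hv]
      rw [listCoeff, listCoeff]
      by_cases h' : l.toFinset = t.erase v
      · rw [if_pos (h.2 h'), if_pos h', listSign_cons, h']
      · rw [if_neg (mt h.1 h'), if_neg h', mul_zero]
  · rw [if_neg hv, listCoeff, if_neg]
    rintro rfl
    exact hv (by simp)

/-- The coefficient of a formal sum of sequences at a set of vertices. -/
def freeCoeff (t : Finset V) : (List V →₀ ℤ) →ₗ[ℤ] ℤ :=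
  Finsupp.linearCombination ℤ (listCoeff e t)

theorem freeCoeff_single (t : Finset V) (l : List V) :
    freeCoeff e t (Finsupp.single l 1) = listCoeff e t l := by
  rw [freeCoeff, Finsupp.linearCombination_single, one_smul]

theorem freeCoeff_consFree (t : Finset V) (v : V) (x : List V →₀ ℤ) :
    freeCoeff e t (consFree v x) =
      if v ∈ t then joinSign e v (t.erase v) * freeCoeff e (t.erase v) x else 0 := by
  induction x using Finsupp.induction_linear with
  | zero => simp
  | add f g hf hg =>
    rw [map_add, map_add, hf, hg, map_add]
    split_ifs <;> ring
  | single l n =>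
    have h : Finsupp.single l n = n • (Finsupp.single l 1 : List V →₀ ℤ) := by simp
    rw [h, map_smul, map_smul, map_smul, freeCoeff_single, consFree, Finsupp.lmapDomain_apply,
      Finsupp.mapDomain_single, freeCoeff_single, listCoeff_cons]
    split_ifs
    · simp only [smul_eq_mul]
      ring
    · rw [smul_zero]

theorem sign_mul_self {e : V → ℤ} (he : Function.Injective e) {v w : V} (h : v ≠ w) :
    Int.sign (e w - e v) * Int.sign (e w - e v) = 1 := by
  rcases lt_trichotomy (e w - e v) 0 with h' | h' | h'
  · rw [Int.sign_eq_neg_one_of_neg h']; rfl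
  · exact absurd (he (sub_eq_zero.1 h')).symm h
  · rw [Int.sign_eq_one_of_pos h']; rfl

theorem joinSign_mul_self {e : V → ℤ} (he : Function.Injective e) {v : V} {t : Finset V}
    (h : v ∉ t) : joinSign e v t * joinSign e v t = 1 := by
  rw [joinSign, ← Finset.prod_mul_distrib]
  exact Finset.prod_eq_one fun w hw => sign_mul_self he (by rintro rfl; exact h hw)

theorem listSign_mul_self {e : V → ℤ} (he : Function.Injective e) {l : List V} (h : l.Nodup) :
    listSign e l * listSign e l = 1 := by
  induction l with
  | nil => rfl
  | cons v l ih =>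
    obtain ⟨hv, hl⟩ := List.nodup_cons.1 h
    rw [listSign_cons, mul_mul_mul_comm, ih hl, mul_one,
      joinSign_mul_self he (by simpa using hv)]

/-- The matrix of d has the incidence signs of δ: its entries are the signs of joining w to t. The
induction uses d(v·l) = l - v·dl. -/
theorem freeCoeff_boundaryList [Fintype V] {e : V → ℤ} (he : Function.Injective e)
    (t : Finset V) (l : List V) :
    freeCoeff e t (boundaryList l) = ∑ w : V, joinSign e w t * listCoeff e (insert w t) l := by
  induction l generalizing t with
  | nil =>
    rw [boundaryList, List.length_nil, Finset.range_zero, Finset.sum_empty, map_zero]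
    refine (Finset.sum_eq_zero fun w _ => ?_).symm
    rw [listCoeff, if_neg, mul_zero]
    exact (Finset.insert_ne_empty w t).symm
  | cons v l ih =>
    rw [boundaryList_cons, map_sub, freeCoeff_single, freeCoeff_consFree]
    by_cases hv : v ∈ t
    -- Write the set as v joined to a smaller t. In the inductive formula for t the term w = v
    -- cancels the coefficient of l, as the join sign squares to 1. The remaining terms match
    -- because exchanging v and w reverses the sign.
    · obtain ⟨t, hvt, rfl⟩ : ∃ t', v ∉ t' ∧ insert v t' = t :=
        ⟨t.erase v, Finset.notMem_erase v t, Finset.insert_erase hv⟩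
      rw [if_pos hv, Finset.erase_insert hvt, ih, Finset.mul_sum,
        ← Finset.add_sum_erase _ _ (Finset.mem_univ v), ← mul_assoc, joinSign_mul_self he hvt,
        one_mul, sub_add_cancel_left, ← Finset.sum_neg_distrib,
        ← Finset.add_sum_erase _ _ (Finset.mem_univ v), joinSign_of_mem e hv, zero_mul, zero_add]
      refine Finset.sum_congr rfl fun w hw => ?_
      have hwv : w ≠ v := Finset.ne_of_mem_erase hw
      rw [listCoeff_cons, if_pos (by simp), Finset.insert_comm w v t, Finset.erase_insert
        (by simpa [hwv.symm] using hvt)]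
      by_cases hwt : w ∈ t
      · rw [joinSign_of_mem e hwt, joinSign_of_mem e (Finset.mem_insert_of_mem hwt)]
        ring
      · have h1 : joinSign e v (insert w t) = Int.sign (e w - e v) * joinSign e v t :=
          Finset.prod_insert hwt
        have h2 : joinSign e w (insert v t) = Int.sign (e v - e w) * joinSign e w t :=
          Finset.prod_insert hvt
        have h3 : Int.sign (e v - e w) = -Int.sign (e w - e v) := by rw [← Int.sign_neg, neg_sub]
        rw [h1, h2, h3]
        linear_combination (joinSign e v t * joinSign e w t * listCoeff e (insert w t) l) *
          sign_mul_self he hwv.symm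
    -- When v ∉ t, the set of v·l can equal t ∪ {w} only for w = v.
    · rw [if_neg hv, sub_zero, Finset.sum_eq_single v]
      · rw [listCoeff_cons, if_pos (Finset.mem_insert_self v t), Finset.erase_insert hv,
          ← mul_assoc, joinSign_mul_self he hv, one_mul]
      · intro w _ hw
        rw [listCoeff_cons, if_neg, mul_zero]
        simpa [hw.symm] using hv
      · exact fun h => absurd (Finset.mem_univ v) h

variable (K : AbstractSimplicialComplex V)

open Classical in
/-- The coefficient of a chain at a set of vertices. -/
def coeff (t : Finset V) : Chains K →ₗ[ℤ] ℤ :=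
  chainFunctional (fun l => if IsFace K t then listCoeff e t l else 0)
    (fun l m a b => by
      split_ifs
      · rw [listCoeff, listCoeff, toFinset_swap]
        split_ifs
        · exact listSign_swap e l m a b
        · rfl
      · rfl)
    (fun l m a => by
      rw [listCoeff, listSign_of_not_nodup, ite_self, ite_self]
      intro h
      have h' := (List.nodup_append.1 h).2.1
      simp at h')
    (fun l hl => by
      split_ifs with h
      · rw [listCoeff, if_neg]
        rintro rfl
        exact hl h
      · rfl)

variable {K}

theorem coeff_simplex {l : List V} (hl : IsFace K l.toFinset) (t : Finset V) :
    coeff e K t (simplex K l) = listCoeff e t l := by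
  rw [coeff, chainFunctional_simplex]
  split_ifs with ht
  · rfl
  · rw [listCoeff, if_neg]
    rintro rfl
    exact ht hl

theorem coeff_of_not_isFace {t : Finset V} (ht : ¬ IsFace K t) : coeff e K t = 0 :=
  chains_hom_ext fun l => by
    rw [coeff, chainFunctional_simplex, if_neg ht, LinearMap.zero_apply]

theorem coeff_chainMk {t : Finset V} (ht : IsFace K t) (x : List V →₀ ℤ) :
    coeff e K t (chainMk K x) = freeCoeff e t x := by
  have h : coeff e K t ∘ₗ chainMk K = freeCoeff e t := by
    refine Finsupp.lhom_ext fun l n => ?_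
    have h : Finsupp.single l n = n • (Finsupp.single l 1 : List V →₀ ℤ) := by simp
    rw [h, map_smul, map_smul, freeCoeff_single, LinearMap.comp_apply]
    congr 1
    refine (chainFunctional_simplex _ _ _ _ l).trans (if_pos ht)
  exact LinearMap.congr_fun h x

variable (K) in
/-- The oriented simplex on a set of vertices. -/
def orientedSimplex (t : Finset V) : Chains K :=
  listSign e t.toList • simplex K t.toList

/-- Reordering changes the simplex and its sign alike, so the oriented simplex does not depend on
the chosen ordering. Transitivity uses that the sign of a repetition-free list squares to 1. -/
theorem listSign_smul_perm {e : V → ℤ} (he : Function.Injective e) {l m : List V}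
    (h : l.Perm m) (hl : l.Nodup) :
    listSign e l • simplex K m = listSign e m • simplex K l := by
  induction h with
  | nil => rfl
  | @cons v l m h ih =>
    have := congrArg (consVertex K v) (ih (List.nodup_cons.1 hl).2)
    rw [map_smul, map_smul, consVertex_simplex, consVertex_simplex] at this
    rw [listSign_cons, listSign_cons, List.toFinset_eq_of_perm _ _ h, mul_smul, mul_smul, this]
  | swap a b l =>
    have h1 := listSign_swap e [] l a b
    have h2 := simplex_swap (K := K) [] [] l a b
    simp only [List.nil_append] at h1 h2
    rw [eq_neg_of_add_eq_zero_left h1, eq_neg_of_add_eq_zero_left h2, smul_neg, neg_smul]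
  | @trans l m n h₁ h₂ ih₁ ih₂ =>
    have hm := (h₁.nodup_iff).1 hl
    have h1 := ih₁ hl
    have h2 := ih₂ hm
    calc listSign e l • simplex K n
        = listSign e l • listSign e m • (listSign e m • simplex K n) := by
          rw [smul_smul (listSign e m), listSign_mul_self he hm, one_smul]
      _ = listSign e m • listSign e n • (listSign e l • simplex K m) := by
          rw [h2]; simp only [smul_smul]; congr 1; ring
      _ = (listSign e m * listSign e m) • listSign e n • simplex K l := by
          rw [h1]; simp only [smul_smul]; congr 1; ring
      _ = listSign e n • simplex K l := by rw [listSign_mul_self he hm, one_smul]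

variable [Fintype V]

theorem sum_coeff_smul_orientedSimplex {e : V → ℤ} (he : Function.Injective e) (x : Chains K) :
    ∑ t : Finset V, coeff e K t x • orientedSimplex e K t = x := by
  suffices h : ∑ t : Finset V, (coeff e K t).smulRight (orientedSimplex e K t) =
      (LinearMap.id : Chains K →ₗ[ℤ] Chains K) by
    simpa only [LinearMap.sum_apply, LinearMap.smulRight_apply, LinearMap.id_apply] using
      LinearMap.congr_fun h x
  refine chains_hom_ext fun l => ?_
  simp only [LinearMap.sum_apply, LinearMap.smulRight_apply, LinearMap.id_apply]
  by_cases hl : IsFace K l.toFinset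
  · by_cases hn : l.Nodup
    · rw [Finset.sum_eq_single l.toFinset]
      · have hp : l.Perm l.toFinset.toList := (List.perm_ext_iff_of_nodup hn
          (Finset.nodup_toList _)).2 fun v => by simp
        rw [coeff_simplex e hl, listCoeff, if_pos rfl, orientedSimplex, smul_comm,
          listSign_smul_perm he hp hn, smul_smul,
          listSign_mul_self he (Finset.nodup_toList _), one_smul]
      · intro t _ ht
        rw [coeff_simplex e hl, listCoeff, if_neg ht.symm, zero_smul]
      · exact fun h => absurd (Finset.mem_univ _) h
    · simp [simplex_eq_zero (K := K) (Or.inl hn)]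
  · simp [simplex_eq_zero (K := K) (Or.inr hl)]

variable (K) in
/-- The pairing for which the oriented simplices are an orthonormal basis. -/
def pairing : Chains K →ₗ[ℤ] Chains K →ₗ[ℤ] ℤ :=
  ∑ t : Finset V, (coeff e K t).smulRight (coeff e K t)

theorem pairing_apply (x y : Chains K) :
    pairing e K x y = ∑ t : Finset V, coeff e K t x * coeff e K t y := by
  simp [pairing, LinearMap.sum_apply]

theorem pairing_comm (x y : Chains K) : pairing e K x y = pairing e K y x := by
  simp only [pairing_apply, mul_comm]

theorem pairing_simplex {l : List V} (hl : IsFace K l.toFinset) (y : Chains K) :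
    pairing e K (simplex K l) y = listSign e l * coeff e K l.toFinset y := by
  rw [pairing_apply, Finset.sum_eq_single l.toFinset]
  · rw [coeff_simplex e hl, listCoeff, if_pos rfl]
  · intro t _ ht
    rw [coeff_simplex e hl, listCoeff, if_neg ht.symm, zero_mul]
  · exact fun h => absurd (Finset.mem_univ _) h

theorem pairing_orientedSimplex {e : V → ℤ} (he : Function.Injective e) (t : Finset V)
    (y : Chains K) : pairing e K (orientedSimplex e K t) y = coeff e K t y := by
  have ht : t.toList.toFinset = t := Finset.toList_toFinset t
  rw [orientedSimplex, map_smul, LinearMap.smul_apply]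
  by_cases hf : IsFace K t
  · rw [pairing_simplex e (by rwa [ht]), ht, smul_eq_mul, ← mul_assoc,
      listSign_mul_self he t.nodup_toList, one_mul]
  · rw [simplex_eq_zero (Or.inr (by rwa [ht])), map_zero, LinearMap.zero_apply, smul_zero,
      coeff_of_not_isFace e hf, LinearMap.zero_apply]

theorem pairing_boundary_simplex {e : V → ℤ} (he : Function.Injective e) (l : List V)
    {m : List V} (hm : m ≠ []) :
    pairing e K (boundary K 1 (simplex K l)) (simplex K m) =
      pairing e K (simplex K l) (coboundary K (simplex K m)) := by
  by_cases hl : IsFace K l.toFinset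
  swap
  · simp [simplex_eq_zero (K := K) (Or.inr hl)]
  by_cases hmf : IsFace K m.toFinset
  swap
  · simp [simplex_eq_zero (K := K) (Or.inr hmf)]
  -- The truncated and full boundaries differ on faces only at vertices, where the full one is (∅);
  -- this has no coefficient at the nonempty set of m.
  have hbd : coeff e K m.toFinset (boundary K 1 (simplex K l)) =
      coeff e K m.toFinset (chainMk K (boundaryList l)) := by
    rw [boundary_mk_single]
    split_ifs with h
    · rfl
    · have h1 : l.length ≤ 1 := not_lt.1 fun h' => h ⟨hl, h'⟩
      rw [map_zero]
      change 0 = coeff e K m.toFinset (bd K l)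
      match l, h1 with
      | [], _ => rw [bd_nil, map_zero]
      | [v], _ =>
        rw [bd_cons, bd_nil, map_zero, sub_zero, coeff_simplex e (Or.inl rfl), listCoeff, if_neg]
        exact fun h => hm ((List.toFinset_eq_empty_iff m).1 h.symm)
  rw [pairing_comm, pairing_simplex e hmf, pairing_simplex e hl, hbd, coeff_chainMk e hmf,
    freeCoeff_boundaryList he, coboundary_simplex, map_sum, Finset.mul_sum, Finset.mul_sum]
  refine Finset.sum_congr rfl fun v _ => ?_
  rw [coeff, chainFunctional_simplex, if_pos hl, listCoeff, listCoeff, List.toFinset_cons,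
    listSign_cons]
  by_cases h : l.toFinset = insert v m.toFinset
  · rw [if_pos h, if_pos h.symm]
    ring
  · rw [if_neg h, if_neg (Ne.symm h)]
    ring

theorem pairing_boundary {e : V → ℤ} (he : Function.Injective e) (x : Chains K) {n : ℤ}
    {y : Chains K} (hy : y ∈ chainGroup K 1 n) :
    pairing e K (boundary K 1 x) y = pairing e K x (coboundary K y) := by
  refine chainGroup_le (P := LinearMap.eqLocus (pairing e K (boundary K 1 x))
    (pairing e K x ∘ₗ coboundary K)) (fun m hm _ => ?_) hy
  rw [LinearMap.mem_eqLocus, LinearMap.comp_apply]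
  have h : (pairing e K).flip (simplex K m) ∘ₗ boundary K 1 =
      (pairing e K).flip (coboundary K (simplex K m)) :=
    chains_hom_ext fun l => pairing_boundary_simplex he l (List.length_pos_iff.1 hm)
  exact LinearMap.congr_fun h x

/-- A generator with nonzero coefficient at t is an ordering of t, so its length puts the oriented
simplex on t in the same degree. -/
theorem coeff_eq_zero_of_mem_chainGroup {n : ℤ} {t : Finset V}
    (ht : orientedSimplex e K t ∉ chainGroup K 1 n) {x : Chains K} (hx : x ∈ chainGroup K 1 n) :
    coeff e K t x = 0 := by
  refine chainGroup_le (P := LinearMap.ker (coeff e K t)) (fun l hl hn => ?_) hx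
  rw [LinearMap.mem_ker]
  by_cases hf : IsFace K l.toFinset
  · rw [coeff_simplex e hf, listCoeff]
    split_ifs with hlt
    · by_cases hnd : l.Nodup
      · have hlen : t.toList.length = l.length := by
          rw [Finset.length_toList, ← hlt, List.toFinset_card_of_nodup hnd]
        exact absurd (Submodule.smul_mem _ _ (simplex_mem_chainGroup (by omega) (by omega))) ht
      · exact listSign_of_not_nodup e hnd
    · rfl
  · rw [simplex_eq_zero (Or.inr hf), map_zero]

variable (K) in
/-- The homomorphism to the dual group induced by the pairing. -/
def pairingMap (n : ℤ) : chainGroup K 1 n →ₗ[ℤ] Module.Dual ℤ (chainGroup K 1 n) where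
  toFun x := (pairing e K x.1).domRestrict (chainGroup K 1 n)
  map_add' x y := by ext z; simp
  map_smul' r x := by ext z; simp

open Classical in
-- The elements b_t satisfy x = ∑ coeff_t(x) b_t and ⟨b_t, x⟩ = coeff_t(x). These two identities
-- give bijectivity without selecting a basis: sets that are not faces, or lie in another degree,
-- contribute zero.
theorem pairingMap_bijective {e : V → ℤ} (he : Function.Injective e) (n : ℤ) :
    Function.Bijective (pairingMap e K n) := by
  let b : Finset V → chainGroup K 1 n := fun t =>
    if h : orientedSimplex e K t ∈ chainGroup K 1 n then ⟨_, h⟩ else 0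
  have hsum : ∀ x : chainGroup K 1 n, ∑ t, coeff e K t x.1 • b t = x := by
    intro x
    refine Subtype.ext ?_
    rw [Submodule.coe_sum]
    refine Eq.trans (Finset.sum_congr rfl fun t _ => ?_) (sum_coeff_smul_orientedSimplex he x.1)
    rw [Submodule.coe_smul]
    by_cases h : orientedSimplex e K t ∈ chainGroup K 1 n
    · rw [show b t = ⟨_, h⟩ from dif_pos h]
    · rw [coeff_eq_zero_of_mem_chainGroup e h x.2, zero_smul, zero_smul]
  have hpair : ∀ t (x : chainGroup K 1 n), pairing e K (b t).1 x.1 = coeff e K t x.1 := by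
    intro t x
    by_cases h : orientedSimplex e K t ∈ chainGroup K 1 n
    · rw [show b t = ⟨_, h⟩ from dif_pos h, pairing_orientedSimplex he]
    · rw [show b t = 0 from dif_neg h, coeff_eq_zero_of_mem_chainGroup e h x.2]
      simp
  constructor
  · rw [injective_iff_map_eq_zero]
    intro x hx
    rw [← hsum x]
    refine Finset.sum_eq_zero fun t _ => ?_
    rw [← hpair, pairing_comm]
    have h : pairing e K x.1 (b t).1 = 0 := LinearMap.congr_fun hx (b t)
    rw [h, zero_smul]
  -- A functional φ is represented by ∑ φ(b_t) b_t.
  · intro φ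
    refine ⟨∑ t, φ (b t) • b t, LinearMap.ext fun y => ?_⟩
    rw [map_sum, LinearMap.sum_apply]
    conv_rhs => rw [← hsum y, map_sum]
    refine Finset.sum_congr rfl fun t _ => ?_
    rw [map_smul, map_smul, LinearMap.smul_apply]
    have h : pairingMap e K n (b t) y = coeff e K t y.1 := hpair t y
    rw [h, smul_eq_mul, smul_eq_mul, mul_comm]

/-- The chain complex is dual to the cochain complex. -/
def chainComplexIso {e : V → ℤ} (he : Function.Injective e) :
    chainComplex K ≅ dualComplex (cochainComplex K) :=
  HomologicalComplex.Hom.isoOfComponents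
    (fun n => (LinearEquiv.ofBijective (pairingMap e K n)
      (pairingMap_bijective he n)).toModuleIso) fun i j hij => by
    have h1 : (chainComplex K).d i j = ModuleCat.ofHom ((boundary K 1).restrict
      fun _ hx => boundary_mem hij hx) := complexOfEnd_d _ _ hij
    have h2 : (cochainComplex K).d j i = ModuleCat.ofHom ((coboundary K).restrict
      fun _ hx => coboundary_mem hij hx) :=
        complexOfEnd_d (c := ComplexShape.up ℤ) _ _ (show j + 1 = i from hij)
    have h3 : (dualComplex (cochainComplex K)).d i j = dualHom ((cochainComplex K).d j i) := rfl
    rw [h1, h3, h2]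
    refine ModuleCat.hom_ext (LinearMap.ext fun (x : chainGroup K 1 i) =>
      LinearMap.ext fun (y : chainGroup K 1 j) => ?_)
    exact (pairing_boundary he x.1 y.2).symm

end Duality

/-! ### Boundedness of the two filtrations. -/

section Convergence

variable {V : Type u} [Fintype V] [DecidableEq V] {K : AbstractSimplicialComplex V}

theorem exists_injective_int (V : Type*) [Fintype V] : ∃ e : V → ℤ, Function.Injective e :=
  ⟨fun v => ((Fintype.equivFin V v : ℕ) : ℤ), fun _ _ h =>
    (Fintype.equivFin V).injective (Fin.ext (Int.ofNat.inj h))⟩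

theorem doubleGroup_eq_bot_of_neg {p q : ℤ} (hp : p < 0) : doubleGroup K 1 p q = ⊥ := by
  refine le_bot_iff.1 (Submodule.span_le.2 ?_)
  rintro _ ⟨s, t, ha, hs, _⟩
  omega

/-- A simplex σ of dimension p has p + 1 entries, so p ≥ |V| forces a repetition. -/
theorem doubleGroup_eq_bot_of_card_le {p q : ℤ} (hp : Fintype.card V ≤ p) :
    doubleGroup K 1 p q = ⊥ := by
  refine le_bot_iff.1 (Submodule.span_le.2 ?_)
  rintro _ ⟨s, t, ha, hs, _, _, rfl⟩
  rw [simplex_eq_zero_of_card_lt (by omega), TensorProduct.zero_tmul]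
  exact Submodule.zero_mem _

theorem cohomeologyFiltration_antitone (n : ℤ) :
    Antitone fun s => cohomeologyFiltration K s n := fun s t hst =>
  Submodule.comap_mono (iSup_mono fun i => iSup_le fun hi =>
    le_iSup_of_le (show i ≤ -s by omega) le_rfl)

theorem cohomeologyFiltration_eq_top {s n : ℤ} (hs : s ≤ -Fintype.card V) :
    cohomeologyFiltration K s n = ⊤ := by
  refine Submodule.submoduleOf_eq_top.2 (iSup_le fun p => ?_)
  by_cases hp : p ≤ -s
  · exact le_iSup_of_le p (le_iSup_of_le hp le_rfl)
  · rw [doubleGroup_eq_bot_of_card_le (by omega)]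
    exact bot_le

theorem cohomeologyFiltration_eq_bot {s n : ℤ} (hs : 1 ≤ s) :
    cohomeologyFiltration K s n = ⊥ := by
  have h : ⨆ i : ℤ, ⨆ _ : i ≤ -s, doubleGroup K 1 i (i + n) = ⊥ := by
    simp only [iSup_eq_bot]
    exact fun i hi => doubleGroup_eq_bot_of_neg (by omega)
  rw [cohomeologyFiltration, h, Submodule.submoduleOf, Submodule.comap_bot, Submodule.ker_subtype]
  rfl

theorem homeologyFiltration_antitone (n : ℤ) :
    Antitone fun s => homeologyFiltration K s n := fun s t hst =>
  Submodule.dualAnnihilator_anti (Submodule.comap_mono (iSup_mono fun i => iSup_le fun hi =>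
    le_iSup_of_le (show i < t by omega) le_rfl))

theorem homeologyFiltration_eq_top {s n : ℤ} (hs : s ≤ 0) : homeologyFiltration K s n = ⊤ := by
  have h : ⨆ i : ℤ, ⨆ _ : i < s, doubleGroup K 1 i (i + n) = ⊥ := by
    simp only [iSup_eq_bot]
    exact fun i hi => doubleGroup_eq_bot_of_neg (by omega)
  rw [homeologyFiltration, h, Submodule.submoduleOf, Submodule.comap_bot, Submodule.ker_subtype]
  exact Submodule.dualAnnihilator_bot

theorem homeologyFiltration_eq_bot {s n : ℤ} (hs : (Fintype.card V : ℤ) ≤ s) :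
    homeologyFiltration K s n = ⊥ := by
  have h : (⨆ i : ℤ, ⨆ _ : i < s, doubleGroup K 1 i (i + n)).submoduleOf
      (totalGroup K 1 n) = ⊤ := by
    refine Submodule.submoduleOf_eq_top.2 (iSup_le fun p => ?_)
    by_cases hp : p < s
    · exact le_iSup_of_le p (le_iSup_of_le hp le_rfl)
    · rw [doubleGroup_eq_bot_of_card_le (by omega)]
      exact bot_le
  rw [homeologyFiltration, h]
  exact Submodule.dualAnnihilator_top

end Convergence

end Homeology

end

/-! ### Assembly of the main theorem. -/

theorem proposition1 {V : Type*} [Fintype V] [DecidableEq V] (K : AbstractSimplicialComplex V) :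
    -- the total cohomology of `N(K)` is `H^*(K)`
    (∀ n : ℤ, Nonempty ((Homeology.totalComplex K 1).homology n ≅
      (Homeology.cochainComplex K).homology n)) ∧
    -- the total homology of the dual is `H_*(K)`
    (∀ n : ℤ, Nonempty ((Homeology.dualTotalComplex K 1).homology n ≅
      (Homeology.chainComplex K).homology n)) ∧
    -- in the reduced cases both are `ℤ`, in degree `0`
    (Nonempty ((Homeology.totalComplex K 0).homology 0 ≃+ ℤ) ∧
      ∀ n : ℤ, n ≠ 0 → Subsingleton ((Homeology.totalComplex K 0).homology n)) ∧
    (Nonempty ((Homeology.dualTotalComplex K 0).homology 0 ≃+ ℤ) ∧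
      ∀ n : ℤ, n ≠ 0 → Subsingleton ((Homeology.dualTotalComplex K 0).homology n)) ∧
    -- the spectral sequences converge to `H^*(K)` and `H_*(K)`
    Homeology.ConvergesTo (Homeology.totalComplex K 1) (Homeology.cohomeologyFiltration K)
      (fun n => (Homeology.cochainComplex K).homology n) ∧
    Homeology.ConvergesTo (Homeology.dualTotalComplex K 1) (Homeology.homeologyFiltration K)
      (fun n => (Homeology.chainComplex K).homology n) := by
  open Homeology in
  obtain ⟨v, hv⟩ := exists_injective_int V
  obtain ⟨f⟩ := nonempty_homotopyEquiv_cochainComplex (K := K)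
  obtain ⟨g⟩ := nonempty_homotopyEquiv_integerComplex (K := K)
  have e₁ : ∀ n : ℤ, (totalComplex K 1).homology n ≅ (cochainComplex K).homology n :=
    fun n => f.toHomologyIso n
  -- The transposed equivalence leads from the dual of C^*(K) to the dual total complex, hence the
  -- inverse; then the dual of C^*(K) is identified with C_*(K).
  have e₂ : ∀ n : ℤ, (dualTotalComplex K 1).homology n ≅ (chainComplex K).homology n := fun n =>
    ((dualHomotopyEquiv f).toHomologyIso n).symm ≪≫
      (HomologicalComplex.homologyMapIso (chainComplexIso hv) n).symm
  have e₃ : ∀ n : ℤ, Nonempty ((totalComplex K 0).homology n ≃ₗ[ℤ] integerComplex.X n) := fun n =>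
    let ⟨h⟩ := nonempty_homologyEquiv_of_d_eq_zero (n := n) integerComplex_d
    ⟨(g.toHomologyIso n).toLinearEquiv.trans h⟩
  have e₄ : ∀ n : ℤ, Nonempty ((dualTotalComplex K 0).homology n ≃ₗ[ℤ]
      (dualComplex integerComplex).X n) := fun n =>
    let ⟨h⟩ := nonempty_homologyEquiv_of_d_eq_zero (n := n) dualComplex_integerComplex_d
    ⟨((dualHomotopyEquiv g).toHomologyIso n).symm.toLinearEquiv.trans h⟩
  obtain ⟨z⟩ := nonempty_integerComplex_zero_equiv
  refine ⟨fun n => ⟨e₁ n⟩, fun n => ⟨e₂ n⟩, ⟨?_, fun n hn => ?_⟩, ⟨?_, fun n hn => ?_⟩, ?_, ?_⟩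
  · obtain ⟨h⟩ := e₃ 0
    exact ⟨(h.trans z).toAddEquiv⟩
  · obtain ⟨h⟩ := e₃ n
    have := subsingleton_integerComplex hn
    exact h.toEquiv.subsingleton
  · obtain ⟨h⟩ := e₄ 0
    have k : (dualComplex integerComplex).X 0 ≃ₗ[ℤ] ℤ :=
      z.symm.dualMap.trans (LinearMap.ringLmapEquivSelf ℤ ℤ ℤ)
    exact ⟨(h.trans k).toAddEquiv⟩
  · obtain ⟨h⟩ := e₄ n
    have := subsingleton_dualComplex_integerComplex hn
    exact h.toEquiv.subsingleton
  · exact convergesTo_of_bounded _ _ cohomeologyFiltration_antitone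
      (fun s n => cohomeologyFiltration_eq_top) (fun s n => cohomeologyFiltration_eq_bot) e₁
  · exact convergesTo_of_bounded _ _ homeologyFiltration_antitone
      (fun s n => homeologyFiltration_eq_top) (fun s n => homeologyFiltration_eq_bot) e₂
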